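/- Write $[n]=\{1,\dots,n\}$. A family of sets is intersecting if $A\cap B\neq\emptyset$ for all members $A,B$. For a family $\mathcal F$ of $k$-element subsets of $[n]$ and $x\in[n]$, let the star of $\mathcal F$ with centre $x$ be $\mathcal F(x)=\{A\in\mathcal F: x\in A\}$; it is full if $|\mathcal F(x)|=\binom{n-1}{k-1}$. Theorem 1.4. Let $k\ge 1$ and $\ell\ge 0$ be integers. There are $n_0=n_0(k,\ell)$ and a function $\varepsilon=\varepsilon_{k,\ell}:\mathbb N\to\mathbb R$ with $\varepsilon(n)\to 0$ as $n\to\infty$, such that the following holds for all integers $n\ge n_0$, all integers $t$ with $2\le t\le\binom{n-1}{k-1}$, and all integers $m$ with $$\binom nk-\binom{n-\ell}k\;\le\; m\;\le\;\binom nk-\binom{n-\ell-1}k .$$ Let $\mathcal F$ be a family of $m$ $k$-element subsets of $[n]$ that has the maximum number of intersecting subfamilies of size $t$ among all families of $m$ $k$-element subsets of $[n]$. Then either (i) $\mathcal F$ contains $\ell$ full stars, i.e. there are $\ell$ distinct $x\in[n]$ with $|\mathcal F(x)|=\binom{n-1}{k-1}$; or (ii) $\mathcal F$ consists of $\ell+1$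 almost-full stars, i.e. there are $\ell+1$ distinct elements $x_1,\dots,x_{\ell+1}\in[n]$ such that $\mathcal F=\mathcal F(x_1)\cup\dots\cup\mathcal F(x_{\ell+1})$ and $|\mathcal F(x_i)|\ge(1-\varepsilon(n))\binom{n-1}{k-1}$ for every $i$. -/

import Mathlib

namespace SetFamily

/-- `int(F, t)`: the number of intersecting subfamilies of `F` consisting of exactly `t` sets.
`Set.Intersecting G` says that `A ∩ B ≠ ∅` for all `A, B ∈ G`. -/
noncomputable def numIntersecting {n : ℕ} (F : Finset (Finset (Fin n))) (t : ℕ) : ℕ := by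
  classical
  exact ((F.powersetCard t).filter
    (fun G : Finset (Finset (Fin n)) => (G : Set (Finset (Fin n))).Intersecting)).card

/-- `F` is a family of exactly `m` sets, all of size `k`, on an `n`-element ground set. -/
def IsUniformOfSize {n : ℕ} (k m : ℕ) (F : Finset (Finset (Fin n))) : Prop :=
  (F : Set (Finset (Fin n))).Sized k ∧ F.card = m

/-- Among the `k`-uniform families on `[n]` with `m` sets, `F` has the maximum number of
intersecting subfamilies of size `t`. -/
def IsOptimal {n : ℕ} (k m t : ℕ) (F : Finset (Finset (Fin n))) : Prop :=
  IsUniformOfSize k m F ∧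
    ∀ F' : Finset (Finset (Fin n)), IsUniformOfSize k m F' →
      numIntersecting F' t ≤ numIntersecting F t

/-- The star of `F` with centre `x`: all the sets of `F` that contain `x`. -/
def star {n : ℕ} (F : Finset (Finset (Fin n))) (x : Fin n) : Finset (Finset (Fin n)) :=
  F.filter (fun A => x ∈ A)

/-- `F` contains `ℓ` full stars: there are `ℓ` distinct centres whose stars in `F` have the
size `C(n-1, k-1)`. -/
def ContainsFullStars {n : ℕ} (k ℓ : ℕ) (F : Finset (Finset (Fin n))) : Prop :=
  ∃ X : Finset (Fin n), X.card = ℓ ∧ ∀ x ∈ X, (star F x).card = (n - 1).choose (k - 1)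

/-- `F` consists of (is the union of) `r` stars with distinct centres, each of them of size at
least `(1 - ε) C(n-1, k-1)`. -/
def ConsistsOfAlmostFullStars {n : ℕ} (k r : ℕ) (ε : ℝ) (F : Finset (Finset (Fin n))) : Prop :=
  ∃ X : Finset (Fin n), X.card = r ∧
    (∀ x ∈ X, (1 - ε) * ((n - 1).choose (k - 1) : ℝ) ≤ ((star F x).card : ℝ)) ∧
    F = X.biUnion (star F)

end SetFamily

/-!
Write `N = C(n - 1, k - 1)` for the size of a full star, `D = C(n - 2, k - 2)` for the number of
`k`-sets through two given points, and `a_x` for the size of the star of `F` with centre `x`. For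
`k ≥ 2` the ratio `D / N` tends to `0`, and every error term below is a bounded multiple of a
quantity that tends to `0` with it. For `k = 1` no `t` is admissible.

An intersecting family either lies in a star or is *nontrivial*, that is, has no common element.
Nontrivial families are rare, uniformly in `t`: such a family through `A` has at most `k` members
that have empty intersection together with `A`, and all but at most `k - 1` of its members other
than `A` are then forced to contain one of at most `k ^ 2` pairs of points
(`card_nontrivialFamilies_le`, `exists_card_nontrivialFamilies_le`). So an optimal `F` has, up to
a small error, `∑ x, C(a_x, t)` intersecting subfamilies of size `t`.

Let `F` be optimal with fewer than `ℓ` full stars. Two comparisons are made.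

* The family made of `ℓ` full stars and a partial star of size `r` is not better than `F`, so
  that `ℓ C(N, t) + C(r, t)` is at most about `∑ x, C(a_x, t)`
  (`IsOptimal.le_sum_choose_star`). In particular the largest star that is not full has size `a`
  proportional to `N` (`exists_max_card_star`).
* Exchanging a member `A` of `F` for a set missing from that largest star is no improvement
  (`IsOptimal.choose_le`). So the stars through `A` provide about as many subfamilies as one star
  of size `a`. This gives a bounded set `H` of centres whose stars cover `F` and have size at
  least about `a`, all other stars being negligible (`exists_large_stars`). Since a set is
  missing from one of these stars, the size of `F` forces `|H| ≥ ℓ + 1`.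

Hence the large stars are full or have size about `a`, with total size about `ℓ N + r`.
By the convexity of `b ↦ C(b, t)`, stated through tangent lines with a quantitative gap
(`tangent_le_choose`, `tangent_add_gap_le_choose`), at least two stars of equal size `a` are
inferior to a collection of full stars and one smaller star of the same total size, unless `a` is
almost `N` (`le_of_choose_add_choose_le`). So all the large stars are almost full, and there
are exactly `ℓ + 1` of them.
-/

namespace SetFamily

open Finset

/-! ### Inequalities between binomial coefficients -/

theorem choose_mul_pow_le {a b : ℕ} (hab : b ≤ a) (u : ℕ) :
    b.choose u * a ^ u ≤ b ^ u * a.choose u := by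
  induction u with
  | zero => simp
  | succ u ih =>
    refine Nat.le_of_mul_le_mul_right (c := u + 1) ?_ u.succ_pos
    have h1 : (b - u) * a ≤ b * (a - u) := by
      rw [Nat.sub_mul, Nat.mul_sub]
      have : b * u ≤ u * a := by rw [mul_comm]; exact Nat.mul_le_mul_left _ hab
      omega
    calc b.choose (u + 1) * a ^ (u + 1) * (u + 1)
        = (b.choose (u + 1) * (u + 1)) * a ^ (u + 1) := by ring
      _ = b.choose u * a ^ u * ((b - u) * a) := by rw [Nat.choose_succ_right_eq]; ring
      _ ≤ b ^ u * a.choose u * (b * (a - u)) := Nat.mul_le_mul ih h1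
      _ = b ^ (u + 1) * (a.choose u * (a - u)) := by ring
      _ = b ^ (u + 1) * a.choose (u + 1) * (u + 1) := by rw [← Nat.choose_succ_right_eq]; ring

/-- For `b ≤ a` the ratio `C(b, u) / C(a, u)` is at most `(b / a) ^ j` for every `j ≤ u`. -/
theorem choose_mul_pow_le_of_le {a b j u : ℕ} (hab : b ≤ a) (hju : j ≤ u) :
    b.choose u * a ^ j ≤ b ^ j * a.choose u := by
  rcases Nat.eq_zero_or_pos a with rfl | ha
  · obtain rfl : b = 0 := by omega
    exact (mul_comm _ _).le
  · refine Nat.le_of_mul_le_mul_right (c := a ^ (u - j)) ?_ (pow_pos ha _)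
    calc b.choose u * a ^ j * a ^ (u - j) = b.choose u * a ^ u := by
          rw [mul_assoc, ← pow_add, Nat.add_sub_cancel' hju]
      _ ≤ b ^ u * a.choose u := choose_mul_pow_le hab u
      _ = b ^ j * b ^ (u - j) * a.choose u := by rw [← pow_add, Nat.add_sub_cancel' hju]
      _ ≤ b ^ j * a ^ (u - j) * a.choose u := by gcongr
      _ = b ^ j * a.choose u * a ^ (u - j) := by ring

/-- `C(b, u) / C(a, u) ≤ c` whenever `b ≤ c a` and `u ≥ 1`. -/
theorem choose_le_mul_choose {a b u : ℕ} (hab : b ≤ a) (hu : 1 ≤ u) {c : ℝ}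
    (hc : (b : ℝ) ≤ c * a) : (b.choose u : ℝ) ≤ c * a.choose u := by
  rcases Nat.eq_zero_or_pos a with rfl | ha
  · obtain rfl : b = 0 := by omega
    obtain ⟨u, rfl⟩ := Nat.exists_eq_add_of_le' hu
    simp
  · have h := choose_mul_pow_le_of_le hab hu
    simp only [pow_one] at h
    have h' : (b.choose u : ℝ) * a ≤ b * a.choose u := by exact_mod_cast h
    have ha' : (0 : ℝ) < a := by exact_mod_cast ha
    refine le_of_mul_le_mul_right (h'.trans ?_) ha'
    calc (b : ℝ) * a.choose u ≤ c * a * a.choose u := by gcongr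
      _ = c * a.choose u * a := by ring

/-- Discrete convexity of `b ↦ C(b, s + 1)`: its graph lies above the tangent line at `a`,
whose slope is `C(a, s)`. -/
theorem tangent_le_choose (a b s : ℕ) :
    (a.choose (s + 1) : ℝ) + ((b : ℝ) - a) * a.choose s ≤ b.choose (s + 1) := by
  rcases le_total a b with h | h
  · induction b, h using Nat.le_induction with
    | base => simp
    | succ b hb ih =>
      have h1 : ((b + 1).choose (s + 1) : ℝ) = b.choose s + b.choose (s + 1) := by
        exact_mod_cast Nat.choose_succ_succ b s
      have h2 : (a.choose s : ℝ) ≤ b.choose s := by exact_mod_cast Nat.choose_le_choose s hb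
      push_cast
      rw [h1]
      linarith
  · induction a, h using Nat.le_induction with
    | base => simp
    | succ a ha ih =>
      have h1 : ((a + 1).choose (s + 1) : ℝ) = a.choose s + a.choose (s + 1) := by
        exact_mod_cast Nat.choose_succ_succ a s
      have h2 : (a.choose s : ℝ) ≤ (a + 1).choose s := by
        exact_mod_cast Nat.choose_le_choose s a.le_succ
      have h3 : (b : ℝ) ≤ a := by exact_mod_cast ha
      push_cast
      rw [h1]
      nlinarith

/-- A quantitative form of strict convexity: at a distance proportional to `N` from the point
of tangency, the graph exceeds the tangent line by a positive proportion of its value. -/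
theorem tangent_add_gap_le_choose {a N s : ℕ} (hs : 1 ≤ s) (ha : 1 ≤ a) {ε : ℝ} (hε : 0 < ε)
    (haN : (a : ℝ) ≤ (1 - ε) * N) (hN : 2 ≤ ε * N) :
    (a.choose (s + 1) : ℝ) + ((N : ℝ) - a) * a.choose s + ε ^ 2 / 8 * N.choose (s + 1) ≤
      N.choose (s + 1) := by
  have haN' : a ≤ N := by
    have : (a : ℝ) ≤ N := by linarith
    exact_mod_cast this
  obtain ⟨c, hc⟩ : ∃ c, c = (a + N) / 2 := ⟨_, rfl⟩
  have hac : a ≤ c := by omega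
  have hcN : c ≤ N := by omega
  have hN0 : (0 : ℝ) < N := by
    have : 1 ≤ N := by omega
    exact_mod_cast this
  have ha0 : (0 : ℝ) < a := by exact_mod_cast ha
  have hacR : (a : ℝ) ≤ c := by exact_mod_cast hac
  have hcNR : (c : ℝ) ≤ N := by exact_mod_cast hcN
  have hc0 : (0 : ℝ) < c := by linarith
  have hc1 : (a : ℝ) + N ≤ 2 * c + 1 := by
    have : a + N ≤ 2 * c + 1 := by omega
    exact_mod_cast this
  have hc2 : 2 * (c : ℝ) ≤ a + N := by
    have : 2 * c ≤ a + N := by omega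
    exact_mod_cast this
  have h1 := tangent_le_choose a c s
  have h2 := tangent_le_choose c N s
  -- the slope at the midpoint `c` is larger than the slope at `a` by the factor `c / a`
  have h3 : (a.choose s : ℝ) * c ≤ a * c.choose s := by
    exact_mod_cast (by simpa using choose_mul_pow_le_of_le hac hs)
  have h4 : (c.choose (s + 1) : ℝ) * N ≤ c * N.choose (s + 1) := by
    exact_mod_cast (by simpa using choose_mul_pow_le_of_le (u := s + 1) hcN s.succ_pos)
  set X : ℝ := (N.choose (s + 1) : ℝ)
  set Y : ℝ := (c.choose (s + 1) : ℝ)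
  set Z : ℝ := (a.choose s : ℝ)
  have hX0 : 0 ≤ X := Nat.cast_nonneg _
  have h5 : c * (((N : ℝ) - c) * Z) ≤ a * (X - Y) := by
    have : (N - c : ℝ) * (Z * c) ≤ (N - c) * (a * c.choose s) :=
      mul_le_mul_of_nonneg_left h3 (by linarith)
    nlinarith
  have h6 : ((N : ℝ) - c) * X ≤ N * (X - Y) := by nlinarith
  have h7 : (c - a : ℝ) * (X - Y) ≤ c * ((X - Y) - (N - c) * Z) := by nlinarith
  have hNc : ε / 2 * N ≤ N - c := by linarith
  have hca : ε / 4 * N ≤ c - a := by linarith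
  have hXY : ε / 2 * X ≤ X - Y := by
    have : N * (ε / 2 * X) ≤ N * (X - Y) := by nlinarith
    exact le_of_mul_le_mul_left this hN0
  have h8 : ε ^ 2 / 8 * X ≤ (X - Y) - (N - c) * Z := by
    have h9 : c * (ε ^ 2 / 8 * X) ≤ c * ((X - Y) - (N - c) * Z) := by
      refine le_trans ?_ h7
      calc c * (ε ^ 2 / 8 * X) ≤ N * (ε ^ 2 / 8 * X) := by gcongr
        _ = (ε / 4 * N) * (ε / 2 * X) := by ring
        _ ≤ (c - a) * (X - Y) := by
          apply mul_le_mul hca hXY (by positivity) (by linarith)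
    exact le_of_mul_le_mul_left h9 hc0
  nlinarith

/-- The estimate behind the count of intersecting families without a common element: replacing
one choice out of a large set by a choice out of a set of `M` elements gains a factor `M / b`. -/
theorem choose_mul_choose_le {Q M b j k u : ℕ} {R : ℝ} (hR : 1 ≤ R) (hQ : (Q : ℝ) ≤ R * b)
    (hjk : j + 1 ≤ k) (hb : 2 * (M + k) ≤ b) :
    (Q.choose j : ℝ) * M * M.choose u ≤
      R ^ k * k.factorial * 4 ^ k * (M / b) * b.choose (j + 1 + u) := by
  rcases lt_or_ge M u with hu | hu
  · rw [Nat.choose_eq_zero_of_lt hu]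
    simp only [Nat.cast_zero, mul_zero]
    positivity
  have hb0 : (0 : ℝ) < b := by
    have : 0 < b := by omega
    exact_mod_cast this
  have h1 : (Q.choose j : ℝ) ≤ (R * b) ^ j := by
    calc (Q.choose j : ℝ) ≤ (Q : ℝ) ^ j := by exact_mod_cast Nat.choose_le_pow Q j
      _ ≤ _ := by gcongr
  have h2 : (M.choose u : ℝ) * b ^ u ≤ M ^ u * b.choose u := by
    exact_mod_cast choose_mul_pow_le (by omega : M ≤ b) u
  have h3 : (b.choose (j + 1 + u) : ℝ) * (j + 1 + u).choose u =
      b.choose u * (b - u).choose (j + 1) := by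
    have := Nat.choose_mul (n := b) (k := j + 1 + u) (s := u) (by omega)
    rw [Nat.add_sub_cancel] at this
    exact_mod_cast this
  have h4 : ((b : ℝ) / 2) ^ (j + 1) ≤ (j + 1).factorial * (b - u).choose (j + 1) := by
    have h := Nat.pow_sub_le_descFactorial (b - u) (j + 1)
    rw [Nat.descFactorial_eq_factorial_mul_choose] at h
    have h' : ((b - u + 1 - (j + 1) : ℕ) : ℝ) ^ (j + 1) ≤
        (j + 1).factorial * (b - u).choose (j + 1) := by exact_mod_cast h
    refine le_trans ?_ h'
    gcongr
    have : b ≤ (b - u + 1 - (j + 1)) * 2 := by omega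
    have : (b : ℝ) ≤ (b - u + 1 - (j + 1) : ℕ) * 2 := by exact_mod_cast this
    linarith
  have h5 : ((j + 1 + u).choose u : ℝ) ≤ 2 ^ (j + 1 + u) := by
    exact_mod_cast Nat.choose_le_two_pow (j + 1 + u) u
  have h6 : (b.choose u : ℝ) * (b / 2) ^ (j + 1) ≤
      (j + 1).factorial * (b.choose (j + 1 + u) * 2 ^ (j + 1 + u)) := by
    calc (b.choose u : ℝ) * (b / 2) ^ (j + 1)
        ≤ b.choose u * ((j + 1).factorial * (b - u).choose (j + 1)) := by gcongr
      _ = (j + 1).factorial * (b.choose (j + 1 + u) * (j + 1 + u).choose u) := by rw [h3]; ring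
      _ ≤ _ := by gcongr
  have hMb : 2 * (M : ℝ) / b ≤ 1 := by
    rw [div_le_one hb0]
    have : 2 * M ≤ b := by omega
    exact_mod_cast this
  have h7 : (M.choose u : ℝ) * (b : ℝ) ^ (j + 1) ≤
      (j + 1).factorial * 4 ^ (j + 1) * b.choose (j + 1 + u) := by
    have h8 : (M.choose u : ℝ) * b ^ u * (b / 2) ^ (j + 1) ≤
        M ^ u * ((j + 1).factorial * (b.choose (j + 1 + u) * 2 ^ (j + 1 + u))) := by
      calc (M.choose u : ℝ) * b ^ u * (b / 2) ^ (j + 1)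
          ≤ M ^ u * b.choose u * (b / 2) ^ (j + 1) := by gcongr
        _ = M ^ u * (b.choose u * (b / 2) ^ (j + 1)) := by ring
        _ ≤ _ := by gcongr
    have h9 : (M.choose u : ℝ) * (b : ℝ) ^ (j + 1) * b ^ u ≤
        (j + 1).factorial * 4 ^ (j + 1) * b.choose (j + 1 + u) * (2 * M) ^ u := by
      have e1 : (M.choose u : ℝ) * (b : ℝ) ^ (j + 1) * b ^ u =
          2 ^ (j + 1) * ((M.choose u : ℝ) * b ^ u * (b / 2) ^ (j + 1)) := by
        rw [div_pow]; field_simp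
      have e2 : ((j + 1).factorial * 4 ^ (j + 1) * b.choose (j + 1 + u) * (2 * M) ^ u : ℝ) =
          2 ^ (j + 1) *
            (M ^ u * ((j + 1).factorial * (b.choose (j + 1 + u) * 2 ^ (j + 1 + u)))) := by
        rw [show (4 : ℝ) = 2 * 2 by norm_num, mul_pow, mul_pow, pow_add 2 (j + 1) u]; ring
      rw [e1, e2]
      gcongr
    have h10 : (2 * (M : ℝ)) ^ u ≤ b ^ u := by
      gcongr
      rwa [div_le_one hb0] at hMb
    refine le_of_mul_le_mul_right (h9.trans ?_) (pow_pos hb0 u)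
    gcongr
  calc (Q.choose j : ℝ) * M * M.choose u
      ≤ (R * b) ^ j * M * M.choose u := by gcongr
    _ = R ^ j * (M / b) * (M.choose u * (b : ℝ) ^ (j + 1)) := by
      rw [mul_pow, pow_succ]; field_simp
    _ ≤ R ^ j * (M / b) * ((j + 1).factorial * 4 ^ (j + 1) * b.choose (j + 1 + u)) := by
      gcongr
    _ ≤ R ^ k * (M / b) * (k.factorial * 4 ^ k * b.choose (j + 1 + u)) := by
      gcongr
      · omega
      · norm_num
    _ = _ := by ring

/-! ### Sizes of stars and of their unions -/

section Counting

variable {n k : ℕ}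

theorem card_uniform_filter_mem (hk : 1 ≤ k) (x : Fin n) :
    #{A ∈ powersetCard k (univ : Finset (Fin n)) | x ∈ A} = (n - 1).choose (k - 1) := by
  have h := card_filter_powersetCard_subset ({x} : Finset (Fin n)) univ k (subset_univ _)
    (by simpa using hk)
  simpa using h

theorem card_uniform_filter_mem_mem (hk : 2 ≤ k) {x y : Fin n} (hxy : x ≠ y) :
    #{A ∈ powersetCard k (univ : Finset (Fin n)) | x ∈ A ∧ y ∈ A} =
      (n - 2).choose (k - 2) := by
  have h2 : #({x, y} : Finset (Fin n)) = 2 := card_pair hxy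
  have h := card_filter_powersetCard_subset ({x, y} : Finset (Fin n)) univ k (subset_univ _)
    (by omega)
  simpa [h2, insert_subset_iff] using h

theorem card_uniform_filter_not_disjoint (H : Finset (Fin n)) :
    #{A ∈ powersetCard k (univ : Finset (Fin n)) | ¬ Disjoint A H} =
      n.choose k - (n - #H).choose k := by
  have h1 : #{A ∈ powersetCard k (univ : Finset (Fin n)) | Disjoint A H} =
      (n - #H).choose k := by
    have : {A ∈ powersetCard k (univ : Finset (Fin n)) | Disjoint A H} = powersetCard k Hᶜ := by
      ext A
      simp only [mem_filter, mem_powersetCard, subset_univ, true_and,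
        subset_compl_iff_disjoint_right, and_comm]
    rw [this, card_powersetCard, card_compl, Fintype.card_fin]
  have h2 := card_filter_add_card_filter_not (s := powersetCard k (univ : Finset (Fin n)))
    (fun A => Disjoint A H)
  rw [card_powersetCard, card_univ, Fintype.card_fin, h1] at h2
  omega

theorem choose_sub_choose_le (n k ℓ : ℕ) (hk : 1 ≤ k) :
    n.choose k - (n - ℓ).choose k ≤ ℓ * (n - 1).choose (k - 1) := by
  induction ℓ with
  | zero => simp
  | succ ℓ ih =>
    have h : (n - ℓ).choose k ≤ (n - (ℓ + 1)).choose k + (n - 1).choose (k - 1) := by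
      obtain ⟨k, rfl⟩ := Nat.exists_eq_add_of_le' hk
      rcases Nat.eq_zero_or_pos (n - ℓ) with h0 | h0
      · rw [h0]; simp
      · have h1 : n - ℓ = n - (ℓ + 1) + 1 := by omega
        rw [h1, Nat.choose_succ_succ]
        have := Nat.choose_le_choose k (show n - (ℓ + 1) ≤ n - 1 by omega)
        simp only [Nat.succ_eq_add_one, Nat.add_sub_cancel]
        omega
    rw [add_mul, one_mul]
    omega

variable {F : Finset (Finset (Fin n))}

theorem star_subset (F : Finset (Finset (Fin n))) (x : Fin n) : star F x ⊆ F := filter_subset _ _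

theorem mem_star {x : Fin n} {A : Finset (Fin n)} : A ∈ star F x ↔ A ∈ F ∧ x ∈ A := mem_filter

theorem card_star_le (hk : 1 ≤ k) (hF : (F : Set (Finset (Fin n))).Sized k) (x : Fin n) :
    #(star F x) ≤ (n - 1).choose (k - 1) := by
  rw [← card_uniform_filter_mem hk x]
  exact card_le_card (filter_subset_filter _ (subset_powersetCard_univ_iff.2 hF))

theorem exists_notMem_of_card_star_lt (hk : 1 ≤ k) {x : Fin n}
    (h : #(star F x) < (n - 1).choose (k - 1)) : ∃ B, #B = k ∧ x ∈ B ∧ B ∉ F := by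
  by_contra! hcon
  rw [← card_uniform_filter_mem hk x] at h
  refine h.not_ge (card_le_card fun B hB => ?_)
  rw [mem_filter, mem_powersetCard_univ] at hB
  exact mem_star.2 ⟨hcon B hB.1 hB.2, hB.2⟩

theorem card_star_inter_star_le (hk : 2 ≤ k) (hF : (F : Set (Finset (Fin n))).Sized k)
    {x y : Fin n} (hxy : x ≠ y) : #(star F x ∩ star F y) ≤ (n - 2).choose (k - 2) := by
  rw [← card_uniform_filter_mem_mem hk hxy]
  refine card_le_card fun A hA => ?_
  rw [mem_inter, mem_star, mem_star] at hA
  rw [mem_filter, mem_powersetCard_univ]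
  exact ⟨hF hA.1.1, hA.1.2, hA.2.2⟩

theorem sum_card_star (hF : (F : Set (Finset (Fin n))).Sized k) :
    ∑ x, #(star F x) = k * #F := by
  have h := sum_card_bipartiteAbove_eq_sum_card_bipartiteBelow (s := (univ : Finset (Fin n)))
    (t := F) (fun x A => x ∈ A)
  simp only [bipartiteAbove, bipartiteBelow, filter_univ_mem] at h
  rw [show ∑ x, #(star F x) = ∑ A ∈ F, #A from h, sum_congr rfl fun A hA => hF hA, sum_const,
    smul_eq_mul, mul_comm]

/-- A Bonferroni inequality for sets with small pairwise intersections. -/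
theorem sum_card_le_card_biUnion_add {ι α : Type*} [DecidableEq ι] [DecidableEq α]
    (s : Finset ι) (P : ι → Finset α) (b : ℕ)
    (h : ∀ i ∈ s, ∀ j ∈ s, i ≠ j → #(P i ∩ P j) ≤ b) :
    ∑ i ∈ s, #(P i) ≤ #(s.biUnion P) + #s ^ 2 * b := by
  induction s using Finset.induction_on with
  | empty => simp
  | insert i s hi ih =>
    have ih' := ih fun a ha c hc => h a (mem_insert_of_mem ha) c (mem_insert_of_mem hc)
    have h1 : #(P i ∩ s.biUnion P) ≤ #s * b := by
      rw [inter_biUnion]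
      refine card_biUnion_le_card_mul _ _ _ fun j hj => ?_
      exact h i (mem_insert_self _ _) j (mem_insert_of_mem hj) (by rintro rfl; exact hi hj)
    have h2 := card_union_add_card_inter (P i) (s.biUnion P)
    rw [sum_insert hi, biUnion_insert, card_insert_of_notMem hi]
    nlinarith

end Counting

/-! ### Nontrivial intersecting families -/

section Nontrivial

variable {n k : ℕ}

open Classical in
/-- The intersecting subfamilies of `F` of size `t` that contain `A` and are not contained in
a star, that is, have no common element. -/
noncomputable def nontrivialFamilies (F : Finset (Finset (Fin n))) (t : ℕ) (A : Finset (Fin n)) :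
    Finset (Finset (Finset (Fin n))) :=
  (F.powersetCard t).filter fun G : Finset (Finset (Fin n)) =>
    (G : Set (Finset (Fin n))).Intersecting ∧ A ∈ G ∧ ∀ x, ∃ B ∈ G, x ∉ B

theorem mem_nontrivialFamilies {F : Finset (Finset (Fin n))} {t : ℕ} {A : Finset (Fin n)}
    {G : Finset (Finset (Fin n))} :
    G ∈ nontrivialFamilies F t A ↔ (G ⊆ F ∧ #G = t) ∧
      (G : Set (Finset (Fin n))).Intersecting ∧ A ∈ G ∧ ∀ x, ∃ B ∈ G, x ∉ B := by
  simp only [nontrivialFamilies, mem_filter, mem_powersetCard]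

/-- The `k`-sets `C` that meet every member of `T` and contain some `x ∈ A` which is missing
from some member of `T`. Such a `C` contains two prescribed elements, `x` and an element of
that member, so that there are few of them. -/
def crossingSets (k : ℕ) (A : Finset (Fin n)) (T : Finset (Finset (Fin n))) :
    Finset (Finset (Fin n)) :=
  {C ∈ powersetCard k (univ : Finset (Fin n)) |
    (∀ E ∈ T, ¬ Disjoint C E) ∧ ∃ x ∈ C, x ∈ A ∧ ∃ E ∈ T, x ∉ E}

theorem mem_crossingSets {A C : Finset (Fin n)} {T : Finset (Finset (Fin n))} :
    C ∈ crossingSets k A T ↔ #C = k ∧ (∀ E ∈ T, ¬ Disjoint C E) ∧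
      ∃ x ∈ C, x ∈ A ∧ ∃ E ∈ T, x ∉ E := by
  rw [crossingSets, mem_filter, mem_powersetCard_univ]

theorem card_crossingSets_le (hk : 2 ≤ k) {A : Finset (Fin n)} (hA : #A = k)
    {T : Finset (Finset (Fin n))} (hT : ∀ E ∈ T, #E = k) :
    #(crossingSets k A T) ≤ k * (k * (n - 2).choose (k - 2)) := by
  have h : ∀ x : Fin n, ∃ E : Finset (Fin n), #E ≤ k ∧ x ∉ E ∧
      ((∃ E ∈ T, x ∉ E) → E ∈ T) := by
    intro x
    by_cases hx : ∃ E ∈ T, x ∉ E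
    · obtain ⟨E, hE, hxE⟩ := hx
      exact ⟨E, (hT E hE).le, hxE, fun _ => hE⟩
    · exact ⟨∅, by simp, by simp, fun h => absurd h hx⟩
  choose e he hxe heT using h
  have hsub : crossingSets k A T ⊆ A.biUnion fun x => (e x).biUnion fun y =>
      {C ∈ powersetCard k (univ : Finset (Fin n)) | x ∈ C ∧ y ∈ C} := by
    intro C hC
    obtain ⟨hCk, hCT, x, hxC, hxA, hx⟩ := mem_crossingSets.1 hC
    obtain ⟨y, hyC, hy⟩ := not_disjoint_iff.1 (hCT _ (heT x hx))
    simp only [mem_biUnion, mem_filter, mem_powersetCard_univ]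
    exact ⟨x, hxA, y, hy, hCk, hxC, hyC⟩
  refine (card_le_card hsub).trans ?_
  rw [← hA]
  refine card_biUnion_le_card_mul _ _ _ fun x _ => ?_
  rw [hA]
  refine (card_biUnion_le_card_mul _ _ _ fun y hy => ?_).trans (Nat.mul_le_mul_right _ (he x))
  exact (card_uniform_filter_mem_mem hk (by rintro rfl; exact hxe _ hy)).le

theorem card_uniform_meeting_le (hk : 1 ≤ k) {A : Finset (Fin n)} (hA : #A = k) :
    #{C ∈ powersetCard k (univ : Finset (Fin n)) | ¬ Disjoint C A} ≤
      k * (n - 1).choose (k - 1) := by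
  have hsub : {C ∈ powersetCard k (univ : Finset (Fin n)) | ¬ Disjoint C A} ⊆
      A.biUnion fun x => {C ∈ powersetCard k (univ : Finset (Fin n)) | x ∈ C} := by
    intro C hC
    rw [mem_filter] at hC
    obtain ⟨x, hxC, hxA⟩ := not_disjoint_iff.1 hC.2
    exact mem_biUnion.2 ⟨x, hxA, mem_filter.2 ⟨hC.1, hxC⟩⟩
  refine (card_le_card hsub).trans ?_
  rw [← hA]
  refine card_biUnion_le_card_mul _ _ _ fun x _ => ?_
  rw [hA]
  exact (card_uniform_filter_mem hk x).le

/-- A nontrivial intersecting family `G` containing `A` has at most `k` members which have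
empty intersection together with `A`. Let `B` be one of these and `S` the set of the others.
Then `S` consists of `k`-sets meeting `A`, whereas `B` and all the remaining members of `G` are
crossing sets, of which there are at most `k² C(n - 2, k - 2)`. -/
theorem card_nontrivialFamilies_le (hk : 2 ≤ k) {F : Finset (Finset (Fin n))}
    (hF : (F : Set (Finset (Fin n))).Sized k) (t : ℕ) {A : Finset (Fin n)} (hA : #A = k) :
    #(nontrivialFamilies F t A) ≤ ∑ j ∈ range k with j + 2 ≤ t,
      (k * (n - 1).choose (k - 1)).choose j * (k * (k * (n - 2).choose (k - 2)) *
        (k * (k * (n - 2).choose (k - 2))).choose (t - 2 - j)) := by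
  classical
  set W : Finset (Finset (Fin n)) :=
    {C ∈ powersetCard k (univ : Finset (Fin n)) | ¬ Disjoint C A} with hW
  have hWk : ∀ C ∈ W, #C = k := fun C hC => by
    rw [hW, mem_filter, mem_powersetCard_univ] at hC
    exact hC.1
  have hsub : nontrivialFamilies F t A ⊆ {j ∈ range k | j + 2 ≤ t}.biUnion fun j =>
      (W.powersetCard j).biUnion fun S => (crossingSets k A (insert A S)).biUnion fun B =>
        ((crossingSets k A (insert A (insert B S))).powersetCard (t - 2 - j)).image
          fun R => insert A (insert B S) ∪ R := by
    intro G hG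
    obtain ⟨⟨hGF, hGt⟩, hGi, hAG, hnt⟩ := mem_nontrivialFamilies.1 hG
    have hGk : ∀ E ∈ G, #E = k := fun E hE => hF (hGF hE)
    choose f hfG hxf using hnt
    have hAne : A.Nonempty := card_pos.1 (by omega)
    obtain ⟨x₀, hx₀⟩ := hAne
    obtain ⟨S₀, hS₀⟩ : ∃ S₀, S₀ = A.image f := ⟨_, rfl⟩
    have hS₀G : S₀ ⊆ G := by
      rw [hS₀]
      exact image_subset_iff.2 fun x _ => hfG x
    have hAS₀ : A ∉ S₀ := by
      rw [hS₀, mem_image]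
      rintro ⟨x, hx, hfx⟩
      exact hxf x (hfx ▸ hx)
    have hBS : f x₀ ∈ S₀ := hS₀ ▸ mem_image_of_mem f hx₀
    have hS₀k : #S₀ ≤ k := by rw [hS₀, ← hA]; exact card_image_le
    have hfS₀ : ∀ x ∈ A, f x ∈ S₀ := fun x hx => hS₀ ▸ mem_image_of_mem f hx
    have hins : insert (f x₀) (S₀.erase (f x₀)) = S₀ := insert_erase hBS
    have hcard1 : #(S₀.erase (f x₀)) + 1 = #S₀ := card_erase_add_one hBS
    have hsubG : insert A S₀ ⊆ G := insert_subset hAG hS₀G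
    have hcard2 : #(insert A S₀) = #S₀ + 1 := card_insert_of_notMem hAS₀
    have hcard3 := card_le_card hsubG
    simp only [mem_biUnion, mem_image]
    refine ⟨#(S₀.erase (f x₀)), ?_, S₀.erase (f x₀), ?_, f x₀, ?_, G \ insert A S₀, ?_, ?_⟩
    · rw [mem_filter, mem_range]; omega
    · refine mem_powersetCard.2 ⟨fun C hC => ?_, rfl⟩
      have hCG := hS₀G (mem_of_mem_erase hC)
      exact mem_filter.2 ⟨mem_powersetCard_univ.2 (hGk C hCG), hGi hCG hAG⟩
    · refine mem_crossingSets.2 ⟨hGk _ (hfG _), fun E hE => hGi (hfG _) ?_, ?_⟩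
      · rcases mem_insert.1 hE with rfl | hE
        · exact hAG
        · exact hS₀G (mem_of_mem_erase hE)
      · obtain ⟨x, hxB, hxA⟩ := not_disjoint_iff.1 (hGi (hfG x₀) hAG)
        refine ⟨x, hxB, hxA, f x, mem_insert_of_mem (mem_erase.2 ⟨fun h => ?_, hfS₀ x hxA⟩),
          hxf x⟩
        exact hxf x (h ▸ hxB)
    · rw [hins]
      refine mem_powersetCard.2 ⟨fun C hC => ?_, ?_⟩
      · have hCG := (mem_sdiff.1 hC).1
        refine mem_crossingSets.2 ⟨hGk C hCG, fun E hE => hGi hCG (hsubG hE), ?_⟩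
        obtain ⟨x, hxC, hxA⟩ := not_disjoint_iff.1 (hGi hCG hAG)
        exact ⟨x, hxC, hxA, f x, mem_insert_of_mem (hfS₀ x hxA), hxf x⟩
      · rw [card_sdiff_of_subset hsubG]; omega
    · rw [hins, union_sdiff_of_subset hsubG]
  refine (card_le_card hsub).trans (card_biUnion_le.trans (sum_le_sum fun j hj => ?_))
  have hAk : ∀ S ⊆ W, ∀ E ∈ insert A S, #E = k := by
    intro S hS E hE
    rcases mem_insert.1 hE with rfl | hE
    · exact hA
    · exact hWk E (hS hE)
  refine (card_biUnion_le_card_mul _ _ (k * (k * (n - 2).choose (k - 2)) *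
    (k * (k * (n - 2).choose (k - 2))).choose (t - 2 - j)) fun S hS => ?_).trans ?_
  · have hS' := (mem_powersetCard.1 hS).1
    refine (card_biUnion_le_card_mul _ _
      ((k * (k * (n - 2).choose (k - 2))).choose (t - 2 - j)) fun B hB => ?_).trans ?_
    · refine card_image_le.trans ?_
      rw [card_powersetCard]
      refine Nat.choose_le_choose _ (card_crossingSets_le hk hA fun E hE => ?_)
      rcases mem_insert.1 hE with rfl | hE
      · exact hA
      · rcases mem_insert.1 hE with rfl | hE
        · exact (mem_crossingSets.1 hB).1
        · exact hWk E (hS' hE)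
    · exact Nat.mul_le_mul_right _ (card_crossingSets_le hk hA (hAk S hS'))
  · rw [card_powersetCard]
    exact Nat.mul_le_mul_right _
      (Nat.choose_le_choose _ (card_uniform_meeting_le (by omega) hA))

end Nontrivial

/-! ### Counting intersecting subfamilies -/

section Intersecting

variable {n k : ℕ} {F : Finset (Finset (Fin n))}

open Classical in
/-- The families counted by `numIntersecting`. -/
noncomputable def intersectingFamilies (F : Finset (Finset (Fin n))) (t : ℕ) :
    Finset (Finset (Finset (Fin n))) :=
  (F.powersetCard t).filter fun G : Finset (Finset (Fin n)) =>
    (G : Set (Finset (Fin n))).Intersecting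

theorem numIntersecting_eq_card (F : Finset (Finset (Fin n))) (t : ℕ) :
    numIntersecting F t = #(intersectingFamilies F t) := rfl

theorem mem_intersectingFamilies {t : ℕ} {G : Finset (Finset (Fin n))} :
    G ∈ intersectingFamilies F t ↔
      (G ⊆ F ∧ #G = t) ∧ (G : Set (Finset (Fin n))).Intersecting := by
  simp only [intersectingFamilies, mem_filter, mem_powersetCard]

theorem intersecting_of_forall_mem {G : Finset (Finset (Fin n))} (x : Fin n)
    (h : ∀ A ∈ G, x ∈ A) : (G : Set (Finset (Fin n))).Intersecting := fun A hA B hB hd =>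
  disjoint_left.1 hd (h A hA) (h B hB)

theorem powersetCard_star_subset (F : Finset (Finset (Fin n))) (t : ℕ) (x : Fin n) :
    (star F x).powersetCard t ⊆ intersectingFamilies F t := fun _ hG =>
  have hG := mem_powersetCard.1 hG
  mem_intersectingFamilies.2 ⟨⟨hG.1.trans (star_subset F x), hG.2⟩,
    intersecting_of_forall_mem x fun _ hA => (mem_star.1 (hG.1 hA)).2⟩

/-- An intersecting family lies in a star or is nontrivial, and a nontrivial one is counted
once for each of its `t` members on the right-hand side. -/
theorem mul_numIntersecting_le (F : Finset (Finset (Fin n))) (t : ℕ) :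
    t * numIntersecting F t ≤
      t * ∑ x, (#(star F x)).choose t + ∑ A ∈ F, #(nontrivialFamilies F t A) := by
  classical
  set T : Finset (Finset (Finset (Fin n))) :=
    (intersectingFamilies F t).filter fun G : Finset (Finset (Fin n)) => ∀ x, ∃ B ∈ G, x ∉ B
    with hT
  have hmemT : ∀ G, G ∈ T ↔ G ∈ intersectingFamilies F t ∧ ∀ x, ∃ B ∈ G, x ∉ B := fun G => by
    rw [hT, mem_filter]
  have hsub : intersectingFamilies F t ⊆
      (univ.biUnion fun x => (star F x).powersetCard t) ∪ T := by
    intro G hG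
    by_cases h : ∃ x, ∀ B ∈ G, x ∈ B
    · obtain ⟨x, hx⟩ := h
      obtain ⟨⟨hGF, hGt⟩, -⟩ := mem_intersectingFamilies.1 hG
      refine mem_union_left _ (mem_biUnion.2 ⟨x, mem_univ _, mem_powersetCard.2 ⟨?_, hGt⟩⟩)
      exact fun A hA => mem_star.2 ⟨hGF hA, hx A hA⟩
    · push Not at h
      exact mem_union_right _ ((hmemT G).2 ⟨hG, h⟩)
  have h1 : numIntersecting F t ≤ ∑ x, (#(star F x)).choose t + #T := by
    rw [numIntersecting_eq_card]
    refine (card_le_card hsub).trans ((card_union_le _ _).trans (Nat.add_le_add_right ?_ _))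
    refine card_biUnion_le.trans (sum_le_sum fun x _ => ?_)
    rw [card_powersetCard]
  have h2 : t * #T ≤ ∑ A ∈ F, #(nontrivialFamilies F t A) := by
    have h := sum_card_bipartiteAbove_eq_sum_card_bipartiteBelow (s := F) (t := T)
      (fun A G => A ∈ G)
    have h3 : ∑ G ∈ T, #(F.bipartiteBelow (fun A G => A ∈ G) G) = t * #T := by
      rw [mul_comm, ← smul_eq_mul]
      refine sum_const_nat fun G hG => ?_
      obtain ⟨⟨hGF, hGt⟩, -⟩ := mem_intersectingFamilies.1 ((hmemT G).1 hG).1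
      rw [← hGt, bipartiteBelow, filter_mem_eq_inter, inter_eq_right.2 hGF]
    rw [← h3, ← h]
    refine sum_le_sum fun A _ => card_le_card fun G hG => ?_
    rw [mem_bipartiteAbove, hmemT, mem_intersectingFamilies] at hG
    exact mem_nontrivialFamilies.2 ⟨hG.1.1.1, hG.1.1.2, hG.2, hG.1.2⟩
  calc t * numIntersecting F t ≤ t * (∑ x, (#(star F x)).choose t + #T) :=
        Nat.mul_le_mul_left _ h1
    _ ≤ _ := by rw [mul_add]; omega

/-- The number of intersecting subfamilies through a member `A` of `F`, compared with the same
number for a set `B` that could replace `A`: since `F` is optimal, the exchange of `A` for `B`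
does not increase the number of intersecting subfamilies. -/
theorem IsOptimal.choose_le {m t : ℕ} (ht : 1 ≤ t) (hF : IsOptimal k m t F)
    {A B : Finset (Fin n)} (hA : A ∈ F) (hB : B ∉ F) (hBk : #B = k) {x : Fin n} (hx : x ∈ B) :
    (#(star F x) - 1).choose (t - 1) ≤
      ∑ y ∈ A, (#(star F y) - 1).choose (t - 1) + #(nontrivialFamilies F t A) := by
  classical
  have hBA : B ∉ F.erase A := fun h => hB (mem_of_mem_erase h)
  have hF' : IsUniformOfSize k m (insert B (F.erase A)) := by
    refine ⟨fun C hC => ?_, ?_⟩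
    · rcases mem_insert.1 hC with rfl | hC
      · exact hBk
      · exact hF.1.1 (mem_of_mem_erase hC)
    · rw [card_insert_of_notMem hBA, card_erase_add_one hA]
      exact hF.1.2
  have hopt := hF.2 _ hF'
  set Q := intersectingFamilies (F.erase A) t
  -- the subfamilies that avoid `A` and `B` are common to both sides
  have hlow : #Q + (#(star F x) - 1).choose (t - 1) ≤
      numIntersecting (insert B (F.erase A)) t := by
    rw [numIntersecting_eq_card]
    set I := ((star (F.erase A) x).powersetCard (t - 1)).image (insert B) with hI
    have hBstar : ∀ S ∈ (star (F.erase A) x).powersetCard (t - 1), B ∉ S := fun S hS h =>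
      hBA (star_subset _ _ ((mem_powersetCard.1 hS).1 h))
    have hIcard : #I = (#(star (F.erase A) x)).choose (t - 1) := by
      rw [hI, card_image_of_injOn, card_powersetCard]
      intro S hS S' hS' h
      rw [← erase_insert (hBstar S hS), ← erase_insert (hBstar S' hS'), h]
    have hstar : #(star F x) - 1 ≤ #(star (F.erase A) x) := by
      have : (star F x).erase A ⊆ star (F.erase A) x := fun C hC => by
        rw [mem_erase, mem_star] at hC
        exact mem_star.2 ⟨mem_erase.2 ⟨hC.1, hC.2.1⟩, hC.2.2⟩
      exact pred_card_le_card_erase.trans (card_le_card this)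
    have hdisj : Disjoint Q I := by
      rw [disjoint_left]
      intro G hG hG'
      obtain ⟨S, -, rfl⟩ := mem_image.1 hG'
      exact hBA ((mem_intersectingFamilies.1 hG).1.1 (mem_insert_self _ _))
    have hsub : Q ∪ I ⊆ intersectingFamilies (insert B (F.erase A)) t := by
      intro G hG
      rcases mem_union.1 hG with hG | hG
      · have hG := mem_intersectingFamilies.1 hG
        exact mem_intersectingFamilies.2 ⟨⟨hG.1.1.trans (subset_insert _ _), hG.1.2⟩, hG.2⟩
      · obtain ⟨S, hS, rfl⟩ := mem_image.1 hG
        have hBS := hBstar S hS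
        have hS := mem_powersetCard.1 hS
        refine mem_intersectingFamilies.2 ⟨⟨?_, ?_⟩, ?_⟩
        · exact insert_subset_insert _ (hS.1.trans (star_subset _ _))
        · rw [card_insert_of_notMem hBS]; omega
        · refine intersecting_of_forall_mem x fun C hC => ?_
          rcases mem_insert.1 hC with rfl | hC
          · exact hx
          · exact (mem_star.1 (hS.1 hC)).2
    have := card_le_card hsub
    rw [card_union_of_disjoint hdisj, hIcard] at this
    have := Nat.choose_le_choose (t - 1) hstar
    omega
  have hupp : numIntersecting F t ≤ #Q +
      (∑ y ∈ A, (#(star F y) - 1).choose (t - 1) + #(nontrivialFamilies F t A)) := by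
    rw [numIntersecting_eq_card]
    have hsub : intersectingFamilies F t ⊆ Q ∪
        ((A.biUnion fun y => (((star F y).erase A).powersetCard (t - 1)).image (insert A)) ∪
          nontrivialFamilies F t A) := by
      intro G hG
      obtain ⟨⟨hGF, hGt⟩, hGi⟩ := mem_intersectingFamilies.1 hG
      by_cases hAG : A ∈ G
      · refine mem_union_right _ ?_
        by_cases h : ∃ y, ∀ C ∈ G, y ∈ C
        · obtain ⟨y, hy⟩ := h
          refine mem_union_left _ (mem_biUnion.2 ⟨y, hy A hAG, mem_image.2 ⟨G.erase A, ?_,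
            insert_erase hAG⟩⟩)
          refine mem_powersetCard.2 ⟨erase_subset_erase _ fun C hC => ?_, ?_⟩
          · exact mem_star.2 ⟨hGF hC, hy C hC⟩
          · rw [card_erase_of_mem hAG, hGt]
        · push Not at h
          exact mem_union_right _ (mem_nontrivialFamilies.2 ⟨⟨hGF, hGt⟩, hGi, hAG, h⟩)
      · refine mem_union_left _ (mem_intersectingFamilies.2 ⟨⟨fun C hC => ?_, hGt⟩, hGi⟩)
        exact mem_erase.2 ⟨fun h => hAG (h ▸ hC), hGF hC⟩
    refine (card_le_card hsub).trans ((card_union_le _ _).trans (Nat.add_le_add_left ?_ _))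
    refine (card_union_le _ _).trans (Nat.add_le_add_right ?_ _)
    refine card_biUnion_le.trans (sum_le_sum fun y hy => ?_)
    refine card_image_le.trans ?_
    rw [card_powersetCard, card_erase_of_mem (mem_star.2 ⟨hA, hy⟩)]
  omega

/-- The family formed by `ℓ` full stars and by part of one further star. -/
theorem exists_uniform_numIntersecting_ge {ℓ m t : ℕ} (hk : 2 ≤ k) (ht : 1 ≤ t) (hn : ℓ < n)
    (hm : n.choose k - (n - ℓ).choose k ≤ m) (hm' : m ≤ n.choose k - (n - ℓ - 1).choose k) :
    ∃ L : Finset (Finset (Fin n)), IsUniformOfSize k m L ∧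
      ℓ * ((n - 1).choose (k - 1)).choose t +
        (m - (n.choose k - (n - ℓ).choose k)).choose t ≤
      numIntersecting L t + ℓ ^ 2 * ((n - 2).choose (k - 2)).choose t := by
  classical
  obtain ⟨H, -, hH⟩ := exists_subset_card_eq (s := (univ : Finset (Fin n))) (n := ℓ)
    (by rw [card_univ, Fintype.card_fin]; exact hn.le)
  obtain ⟨y, hy⟩ : ∃ y, y ∉ H := by
    by_contra! h
    have := card_le_card (fun x _ => h x : univ ⊆ H)
    rw [card_univ, Fintype.card_fin] at this
    omega
  set W := {A ∈ powersetCard k (univ : Finset (Fin n)) | ¬ Disjoint A H} with hW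
  set V := {A ∈ powersetCard k (univ : Finset (Fin n)) | ¬ Disjoint A (insert y H)} with hV
  have hWcard : #W = n.choose k - (n - ℓ).choose k := by
    rw [hW, card_uniform_filter_not_disjoint, hH]
  have hVcard : #V = n.choose k - (n - ℓ - 1).choose k := by
    rw [hV, card_uniform_filter_not_disjoint, card_insert_of_notMem hy, hH, Nat.sub_sub]
  have hWV : W ⊆ V := fun A hA => by
    rw [hW, mem_filter] at hA
    rw [hV, mem_filter]
    exact ⟨hA.1, fun h => hA.2 (h.mono_right (subset_insert _ _))⟩
  obtain ⟨R, hRV, hR⟩ := exists_subset_card_eq (s := V \ W) (n := m - #W) (by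
    rw [card_sdiff_of_subset hWV]
    omega)
  have hWR : Disjoint W R := disjoint_sdiff.mono_right hRV
  have hyR : ∀ A ∈ R, y ∈ A ∧ Disjoint A H := fun A hA => by
    have h1 := mem_sdiff.1 (hRV hA)
    simp only [hV, hW, mem_filter, not_and, not_not, disjoint_insert_right] at h1
    have h2 := h1.2 h1.1.1
    exact ⟨by_contra fun h => h1.1.2 h h2, h2⟩
  have hLk : ((W ∪ R : Finset (Finset (Fin n))) : Set (Finset (Fin n))).Sized k := by
    refine subset_powersetCard_univ_iff.1 (union_subset (filter_subset _ _) ?_)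
    exact hRV.trans (sdiff_subset.trans (filter_subset _ _))
  refine ⟨W ∪ R, ⟨hLk, ?_⟩, ?_⟩
  · rw [card_union_of_disjoint hWR, hR, hWcard]
    omega
  · rw [← hWcard, ← hR, numIntersecting_eq_card]
    have hstar : ∀ x ∈ H, (n - 1).choose (k - 1) ≤ #(star (W ∪ R) x) := fun x hx => by
      rw [← card_uniform_filter_mem (by omega) x]
      refine card_le_card fun A hA => ?_
      rw [mem_filter] at hA
      refine mem_star.2 ⟨mem_union_left _ (mem_filter.2 ⟨hA.1, ?_⟩), hA.2⟩
      exact not_disjoint_iff.2 ⟨x, hA.2, hx⟩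
    have hsum := sum_card_le_card_biUnion_add H (fun x => (star (W ∪ R) x).powersetCard t)
      (((n - 2).choose (k - 2)).choose t) (fun x _ z _ hxz => by
        refine le_trans ?_ (Nat.choose_le_choose t (card_star_inter_star_le hk hLk hxz))
        rw [← card_powersetCard]
        refine card_le_card fun G hG => ?_
        simp only [mem_inter, mem_powersetCard] at hG
        exact mem_powersetCard.2 ⟨subset_inter hG.1.1 hG.2.1, hG.1.2⟩)
    have hlow : ℓ * ((n - 1).choose (k - 1)).choose t ≤
        ∑ x ∈ H, #((star (W ∪ R) x).powersetCard t) := by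
      rw [← hH, ← smul_eq_mul]
      refine card_nsmul_le_sum _ _ _ fun x hx => ?_
      rw [card_powersetCard]
      exact Nat.choose_le_choose t (hstar x hx)
    have hdisj : Disjoint (H.biUnion fun x => (star (W ∪ R) x).powersetCard t)
        (R.powersetCard t) := by
      rw [disjoint_left]
      intro G hG hG'
      obtain ⟨x, hx, hG⟩ := mem_biUnion.1 hG
      rw [mem_powersetCard] at hG hG'
      obtain ⟨A, hA⟩ : G.Nonempty := card_pos.1 (by omega)
      exact disjoint_left.1 (hyR A (hG'.1 hA)).2 (mem_star.1 (hG.1 hA)).2 hx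
    have hsub : (H.biUnion fun x => (star (W ∪ R) x).powersetCard t) ∪ R.powersetCard t ⊆
        intersectingFamilies (W ∪ R) t := by
      refine union_subset (biUnion_subset.2 fun x _ => powersetCard_star_subset _ t x) ?_
      refine (powersetCard_mono fun A hA => ?_).trans (powersetCard_star_subset _ t y)
      exact mem_star.2 ⟨mem_union_right _ hA, (hyR A hA).1⟩
    have := card_le_card hsub
    rw [card_union_of_disjoint hdisj, card_powersetCard] at this
    rw [hH] at hsum
    omega

end Intersecting

/-! ### Asymptotic estimates -/

section Estimates

variable {n k : ℕ} {F : Finset (Finset (Fin n))}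

/-- Nontrivial intersecting families through a given set are negligible in comparison with the
families in a star of size proportional to `C(n - 1, k - 1)`, uniformly in `t`. -/
theorem exists_card_nontrivialFamilies_le (hk : 2 ≤ k) {c δ : ℝ} (hc : 0 < c) (hδ : 0 < δ) :
    ∃ κ : ℝ, 0 < κ ∧ ∀ n : ℕ, 1 ≤ (n - 2).choose (k - 2) →
      ((n - 2).choose (k - 2) : ℝ) ≤ κ * (n - 1).choose (k - 1) →
      ∀ F : Finset (Finset (Fin n)), (F : Set (Finset (Fin n))).Sized k →
      ∀ A : Finset (Fin n), #A = k → ∀ b t : ℕ, c * (n - 1).choose (k - 1) ≤ b →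
        (#(nontrivialFamilies F t A) : ℝ) ≤ δ * b.choose (t - 1) := by
  obtain ⟨R, hR1, hRc⟩ : ∃ R : ℝ, 1 ≤ R ∧ k / c ≤ R :=
    ⟨max 1 (k / c), le_max_left _ _, le_max_right _ _⟩
  have hk0 : (0 : ℝ) < k := by
    have : 0 < k := by omega
    exact_mod_cast this
  set K : ℝ := R ^ k * k.factorial * 4 ^ k
  have hK0 : 0 < K := by positivity
  refine ⟨min (c / (2 * (k ^ 2 + k))) (δ * c / (k ^ 3 * K)), by positivity, ?_⟩
  intro n hD1 hD F hF A hA b t hb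
  set κ : ℝ := min (c / (2 * (k ^ 2 + k))) (δ * c / (k ^ 3 * K))
  set N := (n - 1).choose (k - 1)
  set D := (n - 2).choose (k - 2)
  have hκ1 : κ * (2 * (k ^ 2 + k)) ≤ c := by
    rw [← le_div_iff₀ (by positivity)]
    exact min_le_left _ _
  have hκ2 : κ * (k ^ 3 * K) ≤ δ * c := by
    rw [← le_div_iff₀ (by positivity)]
    exact min_le_right _ _
  have hD1' : (1 : ℝ) ≤ D := by exact_mod_cast hD1
  have hκ0 : 0 < κ := by positivity
  have hN0 : (0 : ℝ) < N := by
    by_contra h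
    have : κ * N ≤ 0 := mul_nonpos_of_nonneg_of_nonpos hκ0.le (not_lt.1 h)
    linarith
  have hb0 : (0 : ℝ) < b := lt_of_lt_of_le (by positivity) hb
  obtain ⟨M, hM⟩ : ∃ M, M = k * (k * D) := ⟨_, rfl⟩
  have hMκ : (M : ℝ) ≤ k ^ 2 * (κ * N) := by
    rw [hM]
    push_cast
    nlinarith [sq_nonneg (k : ℝ)]
  have hbM : 2 * (M + k) ≤ b := by
    have : (2 : ℝ) * (M + k) ≤ b := by
      have h1 : (k : ℝ) ≤ k * (κ * N) := by nlinarith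
      have h2 : κ * (2 * (k ^ 2 + k)) * N ≤ c * N := by gcongr
      nlinarith
    exact_mod_cast this
  have hQ : ((k * N : ℕ) : ℝ) ≤ R * b := by
    push_cast
    calc (k : ℝ) * N = k / c * (c * N) := by field_simp
      _ ≤ R * b := by gcongr
  have hMb : (M : ℝ) / b * (k * K) ≤ δ := by
    rw [div_mul_eq_mul_div, div_le_iff₀ hb0]
    calc (M : ℝ) * (k * K) ≤ k ^ 2 * (κ * N) * (k * K) := by gcongr
      _ = κ * (k ^ 3 * K) * N := by ring
      _ ≤ δ * c * N := by gcongr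
      _ = δ * (c * N) := by ring
      _ ≤ δ * b := by gcongr
  have h := card_nontrivialFamilies_le hk hF t hA
  have h' : (#(nontrivialFamilies F t A) : ℝ) ≤ ∑ j ∈ range k with j + 2 ≤ t,
      ((k * N).choose j : ℝ) * (M * M.choose (t - 2 - j)) := by
    rw [hM]
    exact_mod_cast h
  refine h'.trans ?_
  have hterm : ∀ j ∈ {j ∈ range k | j + 2 ≤ t},
      ((k * N).choose j : ℝ) * (M * M.choose (t - 2 - j)) ≤ K * (M / b) * b.choose (t - 1) := by
    intro j hj
    rw [mem_filter, mem_range] at hj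
    have := choose_mul_choose_le hR1 hQ (by omega : j + 1 ≤ k) hbM (u := t - 2 - j)
    rw [show j + 1 + (t - 2 - j) = t - 1 by omega] at this
    rw [← mul_assoc]
    exact this
  refine (sum_le_card_nsmul _ _ _ hterm).trans ?_
  rw [nsmul_eq_mul]
  have hcard : (#{j ∈ range k | j + 2 ≤ t} : ℝ) ≤ k := by
    exact_mod_cast (card_filter_le _ _).trans (card_range k).le
  calc (#{j ∈ range k | j + 2 ≤ t} : ℝ) * (K * (M / b) * b.choose (t - 1))
      ≤ k * (K * (M / b) * b.choose (t - 1)) := by gcongr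
    _ = M / b * (k * K) * b.choose (t - 1) := by ring
    _ ≤ δ * b.choose (t - 1) := by gcongr

/-- In an optimal family the stars hold almost as many `t`-subfamilies as the stars of the
family made of `ℓ` full stars and a partial one. -/
theorem IsOptimal.le_sum_choose_star {ℓ m t : ℕ} {κ δ : ℝ} (hk : 2 ≤ k) (ht : 2 ≤ t)
    (hn : ℓ < n) (hN : 1 ≤ (n - 1).choose (k - 1))
    (hm : n.choose k - (n - ℓ).choose k ≤ m) (hm' : m ≤ n.choose k - (n - ℓ - 1).choose k)
    (hF : IsOptimal k m t F)
    (hκ : ((n - 2).choose (k - 2) : ℝ) ≤ κ * (n - 1).choose (k - 1)) (hδ : 0 ≤ δ)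
    (hnt : ∀ A ∈ F,
      (#(nontrivialFamilies F t A) : ℝ) ≤ δ * ((n - 1).choose (k - 1) - 1).choose (t - 1)) :
    (ℓ : ℝ) * ((n - 1).choose (k - 1)).choose t +
        (m - (n.choose k - (n - ℓ).choose k)).choose t ≤
      ∑ x, ((#(star F x)).choose t : ℝ) +
        (ℓ ^ 2 * κ + (ℓ + 1) * δ) * ((n - 1).choose (k - 1)).choose t := by
  obtain ⟨L, hL, hLt⟩ := exists_uniform_numIntersecting_ge (t := t) hk (by omega) hn hm hm'
  have h1 := hLt.trans (Nat.add_le_add_right (hF.2 L hL) _)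
  have h2 := mul_numIntersecting_le F t
  have hmN : m ≤ (ℓ + 1) * (n - 1).choose (k - 1) := by
    refine hm'.trans ?_
    rw [Nat.sub_sub]
    exact choose_sub_choose_le n k (ℓ + 1) (by omega)
  have hDN : (n - 2).choose (k - 2) ≤ (n - 1).choose (k - 1) := by
    rcases Nat.eq_zero_or_pos (n - 1) with h0 | h0
    · rw [h0, Nat.choose_eq_zero_of_lt (by omega : 0 < k - 1)] at hN
      omega
    · have := Nat.choose_succ_succ (n - 2) (k - 2)
      rw [show n - 1 = (n - 2).succ by omega, show k - 1 = (k - 2).succ by omega, this]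
      omega
  set N := (n - 1).choose (k - 1)
  set D := (n - 2).choose (k - 2)
  have hDt : (D.choose t : ℝ) ≤ κ * N.choose t := choose_le_mul_choose hDN (by omega) hκ
  have h3 : (∑ A ∈ F, #(nontrivialFamilies F t A) : ℝ) ≤ t * ((ℓ + 1) * δ * N.choose t) := by
    have hid : (t : ℝ) * N.choose t = N * (N - 1).choose (t - 1) := by
      have h := Nat.add_one_mul_choose_eq (N - 1) (t - 1)
      rw [Nat.sub_add_cancel hN, Nat.sub_add_cancel (by omega : 1 ≤ t)] at h
      rw [mul_comm (t : ℝ)]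
      exact_mod_cast h.symm
    refine (sum_le_card_nsmul _ _ _ hnt).trans ?_
    rw [nsmul_eq_mul, hF.1.2]
    have hmN' : (m : ℝ) ≤ (ℓ + 1) * N := by exact_mod_cast hmN
    calc (m : ℝ) * (δ * (N - 1).choose (t - 1)) ≤
        ((ℓ + 1) * N) * (δ * (N - 1).choose (t - 1)) := by gcongr
      _ = (ℓ + 1) * δ * (N * (N - 1).choose (t - 1)) := by ring
      _ = _ := by rw [← hid]; ring
  have ht0 : (0 : ℝ) < t := by
    have : 0 < t := by omega
    exact_mod_cast this
  have h4 : (numIntersecting F t : ℝ) ≤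
      ∑ x, ((#(star F x)).choose t : ℝ) + (ℓ + 1) * δ * N.choose t := by
    refine le_of_mul_le_mul_left ?_ ht0
    rw [mul_add]
    refine le_trans ?_ (add_le_add_right h3 _)
    exact_mod_cast h2
  have h5 : (ℓ : ℝ) * N.choose t + (m - (n.choose k - (n - ℓ).choose k)).choose t ≤
      numIntersecting F t + ℓ ^ 2 * D.choose t := by exact_mod_cast h1
  have h6 : (ℓ : ℝ) ^ 2 * D.choose t ≤ ℓ ^ 2 * (κ * N.choose t) := by gcongr
  linarith

/-- The stars smaller than `u` contribute little to the number of `t`-subfamilies. -/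
theorem sum_choose_star_le {t : ℕ} {N S u : ℝ} (s : Finset (Fin n)) {M : ℕ} (ht : 2 ≤ t)
    (hM : 1 ≤ M) (hNM : N = M) (hstar : ∀ x, #(star F x) ≤ M)
    (hS : ∑ x, (#(star F x) : ℝ) ≤ S * N) (hu : ∀ x ∈ s, (#(star F x) : ℝ) ≤ u * N)
    (hu0 : 0 ≤ u) :
    ∑ x ∈ s, ((#(star F x)).choose t : ℝ) ≤ u * S * M.choose t := by
  have hN0 : 0 < N := by
    rw [hNM]
    exact_mod_cast hM
  have h : ∀ x ∈ s, ((#(star F x)).choose t : ℝ) * N ^ 2 ≤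
      u * N * M.choose t * #(star F x) := by
    intro x hx
    have h1 : ((#(star F x)).choose t : ℝ) * M ^ 2 ≤ (#(star F x)) ^ 2 * M.choose t := by
      exact_mod_cast choose_mul_pow_le_of_le (hstar x) ht
    rw [hNM]
    calc ((#(star F x)).choose t : ℝ) * M ^ 2 ≤ (#(star F x)) ^ 2 * M.choose t := h1
      _ = #(star F x) * (#(star F x) * M.choose t) := by ring
      _ ≤ (u * M) * (#(star F x) * M.choose t) := by
        have := hu x hx
        rw [hNM] at this
        gcongr
      _ = _ := by ring
  have h2 : (∑ x ∈ s, ((#(star F x)).choose t : ℝ)) * N ^ 2 ≤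
      (u * S * M.choose t) * N ^ 2 := by
    rw [sum_mul]
    refine (sum_le_sum h).trans ?_
    rw [← mul_sum]
    calc u * N * M.choose t * ∑ x ∈ s, (#(star F x) : ℝ)
        ≤ u * N * M.choose t * (S * N) := by
          gcongr
          refine le_trans ?_ hS
          exact sum_le_univ_sum_of_nonneg fun x => Nat.cast_nonneg _
      _ = _ := by ring
  exact le_of_mul_le_mul_right h2 (by positivity)

/-- The convexity argument: `g` full stars and one star of size `r` hold considerably more
`t`-subfamilies than `q ≥ g + 1` stars of size at most `a` and of about the same total size,
unless `a` is close to `N`. -/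
theorem le_of_choose_add_choose_le {a r g q s N : ℕ} {ε η₁ η₂ : ℝ} (hs : 1 ≤ s) (ha : 1 ≤ a)
    (hg : 1 ≤ g) (hq : g + 1 ≤ q) (hε : 0 < ε) (hεN : 2 ≤ ε * N) (hsN : s + 1 ≤ N)
    (hη₁ : η₁ ≤ ε ^ 3 / 32) (hη₂ : η₂ ≤ ε ^ 2 / 32)
    (hsum : (q : ℝ) * a ≤ g * N + r + η₁ * N)
    (hglob : (g : ℝ) * N.choose (s + 1) + r.choose (s + 1) ≤
      q * a.choose (s + 1) + η₂ * N.choose (s + 1)) :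
    (1 - ε) * N ≤ a := by
  by_contra! hcon
  have h1 := tangent_add_gap_le_choose hs ha hε hcon.le hεN
  have h2 := tangent_le_choose a r s
  have h3 := tangent_le_choose a 0 s
  have hX0 : (0 : ℝ) < N.choose (s + 1) := by exact_mod_cast Nat.choose_pos hsN
  have hY0 : (0 : ℝ) ≤ a.choose (s + 1) := Nat.cast_nonneg _
  have hZ0 : (0 : ℝ) ≤ a.choose s := Nat.cast_nonneg _
  rw [Nat.choose_zero_succ, Nat.cast_zero] at h3
  set X : ℝ := (N.choose (s + 1) : ℝ)
  set Y : ℝ := (a.choose (s + 1) : ℝ)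
  set Z : ℝ := (a.choose s : ℝ)
  have hg' : (1 : ℝ) ≤ g := by exact_mod_cast hg
  have hq' : (g : ℝ) + 1 ≤ q := by exact_mod_cast hq
  have h4 : (g : ℝ) * (Y + (N - a) * Z + ε ^ 2 / 8 * X) ≤ g * X := by gcongr
  have h5 : ((q : ℝ) - g - 1) * (Y + (0 - a) * Z) ≤ 0 :=
    mul_nonpos_of_nonneg_of_nonpos (by linarith) h3
  have h6 : ((q : ℝ) * a) * Z ≤ (g * N + r + η₁ * N) * Z := by gcongr
  have h7 : ε ^ 2 / 8 * X ≤ g * (ε ^ 2 / 8 * X) := le_mul_of_one_le_left (by positivity) hg'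
  have h8 : ε ^ 2 / 8 * X ≤ η₁ * N * Z + η₂ * X := by nlinarith
  have h9 : ε * N * Z ≤ X := by
    have : ε * N * Z ≤ (N - a) * Z := by
      gcongr
      linarith
    have : 0 ≤ ε ^ 2 / 8 * X := by positivity
    linarith
  have h10 : η₁ * N * Z ≤ ε ^ 2 / 32 * X := by
    calc η₁ * N * Z ≤ ε ^ 3 / 32 * N * Z := by gcongr
      _ = ε ^ 2 / 32 * (ε * N * Z) := by ring
      _ ≤ ε ^ 2 / 32 * X := by gcongr
  have h11 : η₂ * X ≤ ε ^ 2 / 32 * X := by gcongr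
  have : 0 < ε ^ 2 * X := by positivity
  linarith

end Estimates

/-! ### The large stars of an optimal family -/

section Stability

variable {n k : ℕ} {F : Finset (Finset (Fin n))}

theorem card_star_le_mul_of_forall_exists_mem (hk : 2 ≤ k)
    (hF : (F : Set (Finset (Fin n))).Sized k) {x : Fin n} {s : Finset (Fin n)} (hx : x ∉ s)
    (h : ∀ A ∈ star F x, ∃ z ∈ s, z ∈ A) :
    #(star F x) ≤ #s * (n - 2).choose (k - 2) := by
  classical
  have hsub : star F x ⊆ s.biUnion fun z => star F x ∩ star F z := fun A hA => by
    obtain ⟨z, hz, hzA⟩ := h A hA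
    exact mem_biUnion.2 ⟨z, hz, mem_inter.2 ⟨hA, mem_star.2 ⟨star_subset _ _ hA, hzA⟩⟩⟩
  refine (card_le_card hsub).trans (card_biUnion_le_card_mul _ _ _ fun z hz => ?_)
  exact card_star_inter_star_le hk hF (by rintro rfl; exact hx hz)

/-- Suppose that the stars through every member `A` of `F` provide almost as many intersecting
subfamilies through `A` as a single star of size `a` does. Then `F` is covered by boundedly many
large stars, all of size at least about `a`, while all the other stars are negligible. -/
theorem exists_large_stars {N D a t : ℕ} {c K κ δ : ℝ} (hk : 2 ≤ k)
    (hD : D = (n - 2).choose (k - 2))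
    (hF : (F : Set (Finset (Fin n))).Sized k) (hN0 : 1 ≤ N) (hDκ : (D : ℝ) ≤ κ * N)
    (hκ0 : 0 ≤ κ) (ht : 2 ≤ t) (hta : t ≤ a) (hc : 0 < c) (hK : 0 < K)
    (hca : c * N ≤ (a - 1 : ℕ)) (hδ0 : 0 ≤ δ) (hδ : δ ≤ 1 / 4)
    (hκ : 4 * k * K / c * κ < c / (4 * k))
    (hsum : ∑ x, (#(star F x) : ℝ) ≤ K * N)
    (hswap : ∀ A ∈ F, ((a - 1).choose (t - 1) : ℝ) ≤
      ∑ y ∈ A, ((#(star F y) - 1).choose (t - 1) : ℝ) + δ * (a - 1).choose (t - 1)) :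
    ∃ H : Finset (Fin n), (∀ A ∈ F, ∃ x ∈ H, x ∈ A) ∧ (#H : ℝ) ≤ 4 * k * K / c ∧
      (∀ x ∉ H, (#(star F x) : ℝ) ≤ 4 * k * K / c * κ * N) ∧
      (∀ x ∈ H, (1 - (k * (4 * k * K / c * κ / c) + δ)) * a ≤ #(star F x)) ∧
      ∀ x, a ≤ #(star F x) → x ∈ H := by
  have hk0 : (0 : ℝ) < k := by
    have : 0 < k := by omega
    exact_mod_cast this
  have hN0' : (0 : ℝ) < N := by exact_mod_cast hN0
  set K₂ : ℝ := 4 * k * K / c with hK₂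
  have hK₂0 : 0 < K₂ := by positivity
  set Y : ℝ := ((a - 1).choose (t - 1) : ℝ) with hY
  have hY0 : 0 < Y := by
    rw [hY]
    exact_mod_cast Nat.choose_pos (by omega)
  -- stars of size at most `u N` contribute at most the proportion `u / c` of `Y`
  have hsmall : ∀ (x : Fin n) (u : ℝ), (#(star F x) : ℝ) ≤ u * N → 0 ≤ u → u ≤ c →
      ((#(star F x) - 1).choose (t - 1) : ℝ) ≤ u / c * Y := by
    intro x u hx hu0 huc
    have h1 : ((#(star F x) - 1 : ℕ) : ℝ) ≤ u * N := by
      refine le_trans ?_ hx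
      exact_mod_cast Nat.sub_le _ _
    refine choose_le_mul_choose ?_ (by omega) ?_
    · have : ((#(star F x) - 1 : ℕ) : ℝ) ≤ (a - 1 : ℕ) :=
        h1.trans ((mul_le_mul_of_nonneg_right huc hN0'.le).trans hca)
      exact_mod_cast this
    · calc ((#(star F x) - 1 : ℕ) : ℝ) ≤ u * N := h1
        _ = u / c * (c * N) := by field_simp
        _ ≤ u / c * (a - 1 : ℕ) := by gcongr
  have hck : c / (4 * k) ≤ c := by
    refine div_le_self hc.le ?_
    have : (2 : ℝ) ≤ k := by exact_mod_cast hk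
    linarith
  set H : Finset (Fin n) := {x | c / (4 * k) * N ≤ #(star F x)} with hH
  have hmemH : ∀ x, x ∈ H ↔ c / (4 * k) * N ≤ #(star F x) := fun x => by
    rw [hH, mem_filter]
    simp
  have hcover : ∀ A ∈ F, ∃ x ∈ H, x ∈ A := by
    intro A hA
    by_contra! hcon
    have h1 : ∑ y ∈ A, ((#(star F y) - 1).choose (t - 1) : ℝ) ≤ 1 / 4 * Y := by
      refine (sum_le_card_nsmul A _ (c / (4 * k) / c * Y) fun y hy => ?_).trans ?_
      · refine hsmall y _ ?_ (by positivity) hck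
        by_contra h
        exact hcon y ((hmemH y).2 (not_le.1 h).le) hy
      · rw [nsmul_eq_mul, hF hA]
        refine le_of_eq ?_
        field_simp
    have h2 := hswap A hA
    have h3 : δ * Y ≤ 1 / 4 * Y := by gcongr
    linarith
  have hcard : (#H : ℝ) ≤ K₂ := by
    have h1 : #H • (c / (4 * k) * N) ≤ ∑ x ∈ H, (#(star F x) : ℝ) :=
      card_nsmul_le_sum _ _ _ fun x hx => (hmemH x).1 hx
    have h2 : ∑ x ∈ H, (#(star F x) : ℝ) ≤ ∑ x, (#(star F x) : ℝ) :=
      sum_le_univ_sum_of_nonneg fun x => Nat.cast_nonneg _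
    rw [nsmul_eq_mul] at h1
    have h3 : (#H : ℝ) * (c / (4 * k) * N) ≤ K₂ * (c / (4 * k) * N) := by
      have : K₂ * (c / (4 * k) * N) = K * N := by
        rw [hK₂]
        field_simp
      linarith
    exact le_of_mul_le_mul_right h3 (by positivity)
  have hHD : (#H : ℝ) * D ≤ K₂ * κ * N := by
    calc (#H : ℝ) * D ≤ K₂ * (κ * N) := by gcongr
      _ = K₂ * κ * N := by ring
  have hout : ∀ x ∉ H, (#(star F x) : ℝ) ≤ K₂ * κ * N := by
    intro x hx
    have := card_star_le_mul_of_forall_exists_mem hk hF hx fun A hA =>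
      hcover A (star_subset _ _ hA)
    rw [← hD] at this
    refine le_trans ?_ hHD
    exact_mod_cast this
  refine ⟨H, hcover, hcard, hout, ?_, ?_⟩
  · intro x hx
    -- some member of the star of `x` avoids the centres of all the other large stars
    obtain ⟨A, hA, hAx⟩ : ∃ A ∈ star F x, ∀ z ∈ H.erase x, z ∉ A := by
      by_contra! hcon
      have h1 := card_star_le_mul_of_forall_exists_mem hk hF (notMem_erase x H) hcon
      have h2 : (#(star F x) : ℝ) ≤ #H * D := by
        have : #(star F x) ≤ #H * D := by
          rw [hD]
          exact h1.trans (Nat.mul_le_mul_right _ (card_le_card (erase_subset _ _)))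
        exact_mod_cast this
      have h3 := (hmemH x).1 hx
      have h4 : K₂ * κ * N < c / (4 * k) * N := by gcongr
      linarith
    have hxA := (mem_star.1 hA).2
    have h1 := hswap A (star_subset _ _ hA)
    rw [← add_sum_erase _ _ hxA] at h1
    have h2 : ∑ y ∈ A.erase x, ((#(star F y) - 1).choose (t - 1) : ℝ) ≤
        k * (K₂ * κ / c) * Y := by
      refine (sum_le_card_nsmul (A.erase x) _ (K₂ * κ / c * Y) fun y hy => ?_).trans ?_
      · refine hsmall y _ (hout y fun h => ?_) (by positivity) (by linarith)
        exact hAx y (mem_erase.2 ⟨(mem_erase.1 hy).1, h⟩) (mem_erase.1 hy).2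
      · rw [nsmul_eq_mul, mul_assoc]
        have : (#(A.erase x) : ℝ) ≤ k := by
          rw [← hF (star_subset _ _ hA)]
          exact_mod_cast card_le_card (erase_subset _ _)
        gcongr
    set δ' : ℝ := k * (K₂ * κ / c) + δ with hδ'
    have h3 : (1 - δ') * Y ≤ ((#(star F x) - 1).choose (t - 1) : ℝ) := by
      rw [hδ']
      linarith
    have hδ'0 : 0 ≤ δ' := by positivity
    rcases le_total a #(star F x) with hax | hax
    · have h4 : (a : ℝ) ≤ #(star F x) := by exact_mod_cast hax
      have h5 : (0 : ℝ) ≤ δ' * a := by positivity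
      linarith
    · have hx1 : 1 ≤ #(star F x) := card_pos.2 ⟨A, hA⟩
      have h4 : ((#(star F x) - 1).choose (t - 1) : ℝ) * (a - 1 : ℕ) ≤
          (#(star F x) - 1 : ℕ) * Y := by
        have := choose_mul_pow_le_of_le (Nat.sub_le_sub_right hax 1) (by omega : 1 ≤ t - 1)
        rw [pow_one, pow_one] at this
        rw [hY]
        exact_mod_cast this
      have h5 : (1 - δ') * (a - 1 : ℕ) ≤ (#(star F x) - 1 : ℕ) := by
        refine le_of_mul_le_mul_right ?_ hY0
        calc (1 - δ') * (a - 1 : ℕ) * Y = (1 - δ') * Y * (a - 1 : ℕ) := by ring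
          _ ≤ ((#(star F x) - 1).choose (t - 1) : ℝ) * (a - 1 : ℕ) := by gcongr
          _ ≤ _ := h4
      rw [Nat.cast_sub hx1, Nat.cast_sub (by omega : 1 ≤ a), Nat.cast_one] at h5
      linarith
  · intro x hx
    rw [hmemH]
    have h1 : ((a - 1 : ℕ) : ℝ) ≤ #(star F x) := by
      exact_mod_cast (Nat.sub_le _ _).trans hx
    exact ((mul_le_mul_of_nonneg_right hck hN0'.le).trans hca).trans h1

end Stability

section Main

variable {n k : ℕ} {F : Finset (Finset (Fin n))}

theorem card_lt_of_forall_exists_mem {ℓ : ℕ} (hF : (F : Set (Finset (Fin n))).Sized k)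
    {H B : Finset (Fin n)} (hH : #H ≤ ℓ) (hcover : ∀ A ∈ F, ∃ x ∈ H, x ∈ A) {x : Fin n}
    (hx : x ∈ H) (hxB : x ∈ B) (hBk : #B = k) (hB : B ∉ F) :
    #F < n.choose k - (n - ℓ).choose k := by
  have h1 : F ⊂ {A ∈ powersetCard k (univ : Finset (Fin n)) | ¬ Disjoint A H} := by
    refine (ssubset_iff_of_subset fun A hA => ?_).2 ⟨B, ?_, hB⟩
    · obtain ⟨z, hz, hzA⟩ := hcover A hA
      exact mem_filter.2 ⟨mem_powersetCard_univ.2 (hF hA), not_disjoint_iff.2 ⟨z, hzA, hz⟩⟩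
    · exact mem_filter.2 ⟨mem_powersetCard_univ.2 hBk, not_disjoint_iff.2 ⟨x, hxB, hx⟩⟩
  have h2 := card_lt_card h1
  rw [card_uniform_filter_not_disjoint] at h2
  have := Nat.choose_le_choose k (show n - ℓ ≤ n - #H by omega)
  omega

/-- If there are fewer than `ℓ` full stars, but the stars together hold almost `ℓ` times as many
`t`-subfamilies as a full star, then the largest star that is not full is still of size
proportional to `N`. -/
theorem exists_max_card_star {ℓ t N : ℕ} {K η : ℝ} (ht : 2 ≤ t) (htN : t ≤ N) (hN : 1 ≤ N)
    (hK : 0 < K) (hstar : ∀ x, #(star F x) ≤ N)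
    (hsum : ∑ x, (#(star F x) : ℝ) ≤ K * N)
    (hfull : #{x : Fin n | #(star F x) = N} < ℓ) (hη : η ≤ 1 / 2)
    (hglob : (ℓ : ℝ) * N.choose t ≤ ∑ x, ((#(star F x)).choose t : ℝ) + η * N.choose t) :
    ∃ x, #(star F x) < N ∧ (∀ y, #(star F y) < N → #(star F y) ≤ #(star F x)) ∧
      t ≤ #(star F x) ∧ 1 / (2 * K) * N ≤ #(star F x) := by
  have hX0 : (0 : ℝ) < N.choose t := by exact_mod_cast Nat.choose_pos htN
  set X : ℝ := (N.choose t : ℝ) with hX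
  set T : Finset (Fin n) := {x | ¬ #(star F x) = N} with hT
  have hmemT : ∀ x, x ∈ T ↔ #(star F x) < N := fun x => by
    have := hstar x
    rw [hT, mem_filter]
    simp only [mem_univ, true_and]
    omega
  have hsplit := sum_filter_add_sum_filter_not univ (fun x => #(star F x) = N)
    (fun x => ((#(star F x)).choose t : ℝ))
  have h1 : ∑ x with #(star F x) = N, ((#(star F x)).choose t : ℝ) ≤ (ℓ - 1) * X := by
    refine (sum_le_card_nsmul _ _ X fun x hx => ?_).trans ?_
    · rw [(mem_filter.1 hx).2]
    · rw [nsmul_eq_mul]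
      have : (#{x : Fin n | #(star F x) = N} : ℝ) + 1 ≤ ℓ := by exact_mod_cast hfull
      gcongr
      linarith
  have h2 : 1 / 2 * X ≤ ∑ x ∈ T, ((#(star F x)).choose t : ℝ) := by
    have : η * X ≤ 1 / 2 * X := by gcongr
    linarith
  have hTne : T.Nonempty := by
    rw [nonempty_iff_ne_empty]
    intro h
    rw [h, sum_empty] at h2
    linarith
  obtain ⟨x, hxT, hxmax⟩ := exists_max_image T (fun x => #(star F x)) hTne
  refine ⟨x, (hmemT x).1 hxT, fun y hy => hxmax y ((hmemT y).2 hy), ?_, ?_⟩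
  · by_contra! hlt
    have : ∑ y ∈ T, ((#(star F y)).choose t : ℝ) = 0 := sum_eq_zero fun y hy => by
      rw [Nat.choose_eq_zero_of_lt ((hxmax y hy).trans_lt hlt), Nat.cast_zero]
    linarith
  · have hN0 : (0 : ℝ) < N := by exact_mod_cast hN
    have h3 := sum_choose_star_le (F := F) T (u := #(star F x) / N) ht hN rfl hstar hsum
      (fun y hy => by
        rw [div_mul_cancel₀ _ hN0.ne']
        exact_mod_cast hxmax y hy) (by positivity)
    have h4 : 1 / 2 * X ≤ #(star F x) / N * K * X := h2.trans h3
    have h5 : 1 / 2 ≤ #(star F x) / N * K := le_of_mul_le_mul_right h4 hX0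
    rw [div_mul_eq_mul_div, le_div_iff₀ hN0] at h5
    rw [div_mul_eq_mul_div, div_le_iff₀ (by positivity)]
    linarith

/-- The global comparison: if the large stars hold almost as many `t`-subfamilies as `ℓ` full
stars and a star of size `r`, while their total size is about the same, then there are exactly
`ℓ + 1` large stars, all of them almost full. -/
theorem card_eq_and_forall_le_card_star {ℓ t m N a r : ℕ} {ε δ η₁ η₂ : ℝ} {H : Finset (Fin n)}
    (ht : 2 ≤ t) (htN : t ≤ N) (hε : 0 < ε) (hεN : 2 ≤ ε * N) (hεℓ : ε * (8 * (ℓ + 2)) ≤ 1)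
    (hstar : ∀ x, #(star F x) ≤ N) (haN : a < N) (ha : 1 ≤ a)
    (hmax : ∀ y, #(star F y) < N → #(star F y) ≤ a)
    (hlarge : ∀ x ∈ H, (1 - δ) * a ≤ #(star F x)) (hmem : ∀ x, a ≤ #(star F x) → x ∈ H)
    (hfull : #{x : Fin n | #(star F x) = N} < ℓ) (hH : ℓ + 1 ≤ #H) (hδ0 : 0 ≤ δ)
    (hδε : δ ≤ ε) (hHsum : ∑ x ∈ H, (#(star F x) : ℝ) ≤ m + η₁ * N)
    (hmr : (m : ℝ) ≤ ℓ * N + r) (hmN : (m : ℝ) ≤ (ℓ + 1) * N)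
    (hη₁ : η₁ + #H * δ ≤ ε ^ 3 / 32) (hη₂ : η₂ ≤ ε ^ 2 / 32)
    (hglob : (ℓ : ℝ) * N.choose t + r.choose t ≤
      ∑ x ∈ H, ((#(star F x)).choose t : ℝ) + η₂ * N.choose t) :
    #H = ℓ + 1 ∧ ∀ x ∈ H, (1 - 2 * ε) * N ≤ #(star F x) := by
  have hN0 : (0 : ℝ) < N := by
    have : 0 < N := by omega
    exact_mod_cast this
  have hℓ0 : (0 : ℝ) ≤ ℓ := Nat.cast_nonneg ℓ
  have hε16 : ε ≤ 1 / 16 := by nlinarith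
  -- the large stars that are full, and those that are not
  set H₁ : Finset (Fin n) := {x | #(star F x) = N} with hH₁
  have hH₁H : H₁ ⊆ H := fun x hx => hmem x (by
    have := (mem_filter.1 hx).2
    omega)
  have hH₂ : ∀ x ∈ H \ H₁, #(star F x) ≤ a := fun x hx => by
    refine hmax x (lt_of_le_of_ne (hstar x) fun h => (mem_sdiff.1 hx).2 ?_)
    exact mem_filter.2 ⟨mem_univ _, h⟩
  obtain ⟨q, hq⟩ : ∃ q, q = #(H \ H₁) := ⟨_, rfl⟩
  have hqH : q + #H₁ = #H := by rw [hq]; exact card_sdiff_add_card_eq_card hH₁H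
  obtain ⟨g, hg⟩ : ∃ g, ℓ = g + #H₁ := ⟨ℓ - #H₁, by omega⟩
  have hgR : (ℓ : ℝ) = g + #H₁ := by exact_mod_cast hg
  have hqK : (q : ℝ) ≤ #H := by exact_mod_cast (by omega : q ≤ #H)
  have hsplit : ∀ f : Fin n → ℝ, ∑ x ∈ H \ H₁, f x + ∑ x ∈ H₁, f x = ∑ x ∈ H, f x :=
    fun f => sum_sdiff hH₁H
  have haN' : (1 - ε) * N ≤ a := by
    obtain ⟨s, rfl⟩ : ∃ s, t = s + 1 := ⟨t - 1, by omega⟩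
    refine le_of_choose_add_choose_le (η₁ := η₁ + #H * δ) (η₂ := η₂) (by omega : 1 ≤ s) ha
      (by omega : 1 ≤ g) (by omega : g + 1 ≤ q) hε hεN htN hη₁ hη₂ (r := r) ?_ ?_
    · have h1 : ∑ x ∈ H₁, (#(star F x) : ℝ) = #H₁ * N := by
        rw [← nsmul_eq_mul]
        refine sum_eq_card_nsmul fun x hx => ?_
        rw [(mem_filter.1 hx).2]
      have h2 : (q : ℝ) * ((1 - δ) * a) ≤ ∑ x ∈ H \ H₁, (#(star F x) : ℝ) := by
        rw [hq, ← nsmul_eq_mul]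
        exact card_nsmul_le_sum _ _ _ fun x hx => hlarge x (sdiff_subset hx)
      have h3 := hsplit fun x => (#(star F x) : ℝ)
      have h4 : (q : ℝ) * (δ * a) ≤ #H * (δ * N) := by
        have : (a : ℝ) ≤ N := by exact_mod_cast haN.le
        gcongr
      rw [hgR] at hmr
      linarith
    · have h1 : ∑ x ∈ H₁, ((#(star F x)).choose (s + 1) : ℝ) = #H₁ * N.choose (s + 1) := by
        rw [← nsmul_eq_mul]
        refine sum_eq_card_nsmul fun x hx => ?_
        rw [(mem_filter.1 hx).2]
      have h2 : ∑ x ∈ H \ H₁, ((#(star F x)).choose (s + 1) : ℝ) ≤ q * a.choose (s + 1) := by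
        rw [hq, ← nsmul_eq_mul]
        refine sum_le_card_nsmul _ _ _ fun x hx => ?_
        exact_mod_cast Nat.choose_le_choose _ (hH₂ x hx)
      have h3 := hsplit fun x => ((#(star F x)).choose (s + 1) : ℝ)
      rw [← h3, h1, hgR] at hglob
      linarith
  have hfinal : ∀ x ∈ H, (1 - 2 * ε) * N ≤ #(star F x) := fun x hx => by
    refine le_trans ?_ (hlarge x hx)
    calc (1 - 2 * ε) * N ≤ (1 - ε) * ((1 - ε) * N) := by
          have : 0 ≤ ε ^ 2 * N := by positivity
          linarith
      _ ≤ (1 - δ) * a := by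
        have h2 : 0 ≤ 1 - ε := by linarith
        have h3 : 0 ≤ 1 - δ := by linarith
        gcongr
  refine ⟨le_antisymm ?_ hH, hfinal⟩
  by_contra! hlt
  have h1 : #H • ((1 - 2 * ε) * (N : ℝ)) ≤ ∑ x ∈ H, (#(star F x) : ℝ) :=
    card_nsmul_le_sum _ _ _ hfinal
  rw [nsmul_eq_mul] at h1
  have h2 : (ℓ : ℝ) + 2 ≤ #H := by exact_mod_cast hlt
  have h3 : ((ℓ : ℝ) + 2) * ((1 - 2 * ε) * N) ≤ #H * ((1 - 2 * ε) * N) := by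
    have : 0 ≤ 1 - 2 * ε := by linarith
    gcongr
  have h4 : ((ℓ : ℝ) + 2) * (1 - 2 * ε) * N ≤ (ℓ + 1 + η₁) * N := by linarith
  have h5 := le_of_mul_le_mul_right h4 hN0
  have h6 : ε ^ 3 ≤ 1 := pow_le_one₀ hε.le (by linarith)
  have h7 : 0 ≤ #H * δ := by positivity
  linarith

/-- The theorem for one error `2 ε` in place of a sequence of errors, where the condition that
`n` is large is expressed by `C(n - 2, k - 2)` being much smaller than `C(n - 1, k - 1)`. -/
theorem exists_forall_containsFullStars_or {ℓ : ℕ} (hk : 2 ≤ k) {ε : ℝ} (hε : 0 < ε)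
    (hε' : ε ≤ 1 / (8 * (ℓ + 2))) :
    ∃ κ : ℝ, 0 < κ ∧ ∀ n : ℕ, ℓ < n → 1 ≤ (n - 2).choose (k - 2) →
      ((n - 2).choose (k - 2) : ℝ) ≤ κ * (n - 1).choose (k - 1) →
      ∀ t m : ℕ, 2 ≤ t → t ≤ (n - 1).choose (k - 1) →
        n.choose k - (n - ℓ).choose k ≤ m → m ≤ n.choose k - (n - ℓ - 1).choose k →
        ∀ F : Finset (Finset (Fin n)), IsOptimal k m t F →
          ContainsFullStars k ℓ F ∨ ConsistsOfAlmostFullStars k (ℓ + 1) (2 * ε) F := by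
  have hk0 : (0 : ℝ) < k := by
    have : 0 < k := by omega
    exact_mod_cast this
  have hk2 : (2 : ℝ) ≤ k := by exact_mod_cast hk
  have hℓ0 : (0 : ℝ) ≤ ℓ := Nat.cast_nonneg ℓ
  obtain ⟨K, hK⟩ : ∃ K : ℝ, K = k * (ℓ + 1) := ⟨_, rfl⟩
  have hK2 : 2 ≤ K := by rw [hK]; nlinarith
  have hK0 : 0 < K := by linarith
  obtain ⟨c, hc⟩ : ∃ c : ℝ, c = 1 / (4 * K) := ⟨_, rfl⟩
  have hc0 : 0 < c := by rw [hc]; positivity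
  have hc1 : c ≤ 1 / 8 := by
    rw [hc]
    exact one_div_le_one_div_of_le (by norm_num) (by linarith)
  -- `K₂` bounds the number of large stars
  obtain ⟨K₂, hK₂⟩ : ∃ K₂ : ℝ, K₂ = 4 * k * K / c := ⟨_, rfl⟩
  have hK₂0 : 0 < K₂ := by rw [hK₂]; positivity
  have hε16 : ε ≤ 1 / 16 := hε'.trans (one_div_le_one_div_of_le (by norm_num) (by linarith))
  have hεℓ : ε * (8 * (ℓ + 2)) ≤ 1 := by
    rwa [← le_div_iff₀ (by positivity)]
  obtain ⟨β, hβ⟩ : ∃ β : ℝ, β = ε ^ 3 / 32 := ⟨_, rfl⟩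
  have hβ0 : 0 < β := by rw [hβ]; positivity
  have hε2 : ε ^ 2 ≤ ε := by nlinarith
  have hβε2 : β ≤ ε ^ 2 / 32 := by rw [hβ]; nlinarith [sq_nonneg ε]
  have hβε : β ≤ ε / 32 := by linarith
  obtain ⟨C₁, hC₁⟩ : ∃ C₁ : ℝ, C₁ = ℓ ^ 2 + (ℓ + 1) + K₂ * K := ⟨_, rfl⟩
  obtain ⟨C₂, hC₂⟩ : ∃ C₂ : ℝ, C₂ = k * (K₂ / c) + 1 := ⟨_, rfl⟩
  obtain ⟨C₃, hC₃⟩ : ∃ C₃ : ℝ, C₃ = K₂ ^ 2 + K₂ * C₂ := ⟨_, rfl⟩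
  have hC₁0 : 0 < C₁ := by rw [hC₁]; positivity
  have hC₂0 : 0 < C₂ := by rw [hC₂]; positivity
  have hC₃0 : 0 < C₃ := by rw [hC₃]; positivity
  have hpos : 0 < 8 * k * K₂ / c := by positivity
  -- `θ` bounds both the ratio of the binomial coefficients and the proportion of nontrivial
  -- intersecting families; all error terms below are bounded multiples of it
  obtain ⟨θ, hθ⟩ : ∃ θ : ℝ, θ = β / (C₁ + C₂ + C₃ + 4 * K + 8 * k * K₂ / c) := ⟨_, rfl⟩
  have hθ0 : 0 < θ := by rw [hθ]; positivity
  have hle : ∀ x, x ≤ C₁ + C₂ + C₃ + 4 * K + 8 * k * K₂ / c → x * θ ≤ β := fun x hx => by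
    rw [hθ, ← mul_div_assoc, div_le_iff₀ (by positivity), mul_comm β]
    gcongr
  have hθ₁ : C₁ * θ ≤ β := hle _ (by linarith)
  have hθ₂ : C₂ * θ ≤ β := hle _ (by linarith)
  have hθ₃ : C₃ * θ ≤ β := hle _ (by linarith)
  have hθ₄ : 4 * K * θ ≤ β := hle _ (by linarith)
  have hθ₅ : 8 * k * K₂ / c * θ ≤ β := hle _ (by linarith)
  have hθβ : θ ≤ β := (le_mul_of_one_le_left hθ0.le (by linarith)).trans hθ₄
  obtain ⟨κ₀, hκ₀, hnt⟩ := exists_card_nontrivialFamilies_le hk hc0 hθ0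
  refine ⟨min κ₀ θ, lt_min hκ₀ hθ0, ?_⟩
  intro n hn hD1 hD t m ht htN hm hm' F hF
  have hstar := card_star_le (F := F) (by omega : 1 ≤ k) hF.1.1
  have hlow := fun hnt' => hF.le_sum_choose_star (κ := θ) (δ := θ) hk ht hn (by omega) hm hm'
    (hD.trans (mul_le_mul_of_nonneg_right (min_le_right _ _) (Nat.cast_nonneg _))) hθ0.le hnt'
  have hmissing := fun x => exists_notMem_of_card_star_lt (F := F) (x := x) (by omega : 1 ≤ k)
  have hmℓ := choose_sub_choose_le n k ℓ (by omega)
  have hmℓ' : m ≤ (ℓ + 1) * (n - 1).choose (k - 1) := by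
    refine hm'.trans ?_
    rw [Nat.sub_sub]
    exact choose_sub_choose_le n k (ℓ + 1) (by omega)
  have hinter := fun x y => card_star_inter_star_le (F := F) (x := x) (y := y) hk hF.1.1
  have hDθ : ((n - 2).choose (k - 2) : ℝ) ≤ θ * (n - 1).choose (k - 1) :=
    hD.trans (mul_le_mul_of_nonneg_right (min_le_right _ _) (Nat.cast_nonneg _))
  have hnt' := fun A (hA : A ∈ F) (b : ℕ) => hnt n hD1
    (hD.trans (mul_le_mul_of_nonneg_right (min_le_left _ _) (Nat.cast_nonneg _))) F hF.1.1 A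
    (hF.1.1 hA) b t
  have hDdef : ∃ D, D = (n - 2).choose (k - 2) := ⟨_, rfl⟩
  have hNdef : ∃ N, N = (n - 1).choose (k - 1) := ⟨_, rfl⟩
  obtain ⟨D, hDe⟩ := hDdef
  obtain ⟨N, hNe⟩ := hNdef
  obtain ⟨r, hr⟩ : ∃ r, r = m - (n.choose k - (n - ℓ).choose k) := ⟨_, rfl⟩
  rw [← hDe] at hD1 hDθ
  simp only [← hDe] at hinter
  rw [← hNe] at htN hmℓ hmℓ' hDθ
  simp only [← hNe] at hstar hmissing hnt'
  rw [← hNe, ← hr] at hlow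
  have hN1 : 1 ≤ N := by omega
  have hN0 : (0 : ℝ) < N := by exact_mod_cast hN1
  have hD1' : (1 : ℝ) ≤ D := by exact_mod_cast hD1
  have hθN : 1 ≤ θ * N := hD1'.trans hDθ
  have hKN : 4 * K ≤ N := by
    calc 4 * K ≤ 4 * K * (θ * N) := le_mul_of_one_le_right (by positivity) hθN
      _ = 4 * K * θ * N := by ring
      _ ≤ 1 * N := by
        gcongr
        linarith
      _ = N := one_mul _
  have hεN : 2 ≤ ε * N := by
    calc 2 ≤ 2 * (θ * N) := by linarith
      _ = 2 * θ * N := by ring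
      _ ≤ ε * N := by
        gcongr
        linarith
  have hmr : m ≤ ℓ * N + r := by omega
  have hmr' : (m : ℝ) ≤ ℓ * N + r := by exact_mod_cast hmr
  have hmN : (m : ℝ) ≤ (ℓ + 1) * N := by exact_mod_cast hmℓ'
  have hsum : ∑ x, (#(star F x) : ℝ) ≤ K * N := by
    have h1 := sum_card_star hF.1.1
    rw [hF.1.2] at h1
    have h2 : ∑ x, (#(star F x) : ℝ) = k * m := by exact_mod_cast h1
    rw [h2, hK, mul_assoc]
    gcongr
  have hglob := hlow fun A hA => hnt' A hA (N - 1) (by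
    rw [Nat.cast_sub hN1, Nat.cast_one]
    have : c * N ≤ 1 / 8 * N := by gcongr
    linarith)
  have hη₁ : (ℓ : ℝ) ^ 2 * θ + (ℓ + 1) * θ ≤ β := by
    refine le_trans ?_ hθ₁
    rw [hC₁]
    have := mul_pos (mul_pos hK₂0 hK0) hθ0
    linarith
  by_cases hfull : ℓ ≤ #{x : Fin n | #(star F x) = N}
  · left
    obtain ⟨X, hX, hXℓ⟩ := exists_subset_card_eq hfull
    exact ⟨X, hXℓ, fun x hx => by rw [(mem_filter.1 (hX hx)).2, hNe]⟩
  right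
  rw [not_le] at hfull
  obtain ⟨x₀, hx₀N, hx₀max, htx₀, hx₀⟩ := exists_max_card_star ht htN hN1 hK0 hstar hsum hfull
    (η := ℓ ^ 2 * θ + (ℓ + 1) * θ) (by linarith)
    (by
      refine le_trans ?_ hglob
      exact le_add_of_nonneg_right (Nat.cast_nonneg _))
  obtain ⟨B, hBk, hxB, hBF⟩ := hmissing x₀ hx₀N
  obtain ⟨a, ha⟩ : ∃ a, a = #(star F x₀) := ⟨_, rfl⟩
  rw [← ha] at hx₀N hx₀max htx₀ hx₀
  have ha1 : 1 ≤ a := by omega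
  have hca : c * N ≤ (a - 1 : ℕ) := by
    rw [Nat.cast_sub ha1, Nat.cast_one]
    have h1 : 1 / (2 * K) * N = c * N + c * N := by rw [hc]; field_simp; ring
    have h2 : 1 ≤ c * N := by
      rw [hc, div_mul_eq_mul_div, le_div_iff₀ (by positivity)]
      linarith
    linarith
  obtain ⟨H, hcover, hHcard, hout, hlarge, hmem⟩ := exists_large_stars (a := a) (t := t) (c := c)
    (K := K) (κ := θ) (δ := θ) hk hDe hF.1.1 hN1 hDθ hθ0.le ht htx₀ hc0 hK0 hca hθ0.le
    (by linarith)
    (by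
      rw [← hK₂, lt_div_iff₀ (by positivity)]
      have : K₂ * θ * (4 * k) = c / 2 * (8 * k * K₂ / c * θ) := by field_simp; ring
      rw [this]
      have : c / 2 * (8 * k * K₂ / c * θ) ≤ c / 2 * β := by gcongr
      have : c / 2 * β < c * 1 := by
        refine mul_lt_mul'' (by linarith) (by linarith) (by positivity) hβ0.le
      linarith)
    hsum
    (fun A hA => by
      have h1 := hF.choose_le (by omega) hA hBF hBk hxB
      rw [← ha] at h1
      have h2 := hnt' A hA (a - 1) hca
      have h3 : ((a - 1).choose (t - 1) : ℝ) ≤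
          ∑ y ∈ A, ((#(star F y) - 1).choose (t - 1) : ℝ) + #(nontrivialFamilies F t A) := by
        exact_mod_cast h1
      linarith)
  rw [← hK₂] at hHcard hout hlarge
  obtain ⟨δ', hδ'⟩ : ∃ δ' : ℝ, δ' = k * (K₂ * θ / c) + θ := ⟨_, rfl⟩
  rw [← hδ'] at hlarge
  have hδ'C : δ' = C₂ * θ := by rw [hδ', hC₂]; ring
  have hδ'0 : 0 < δ' := by rw [hδ'C]; positivity
  have hHℓ : ℓ + 1 ≤ #H := by
    by_contra! hlt
    have := card_lt_of_forall_exists_mem hF.1.1 (by omega : #H ≤ ℓ) hcover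
      (hmem x₀ ha.le) hxB hBk hBF
    rw [hF.1.2] at this
    omega
  have hHunion : H.biUnion (star F) = F := by
    ext A
    rw [mem_biUnion]
    constructor
    · rintro ⟨x, -, hA⟩
      exact star_subset _ _ hA
    · intro hA
      obtain ⟨x, hx, hxA⟩ := hcover A hA
      exact ⟨x, hx, mem_star.2 ⟨hA, hxA⟩⟩
  have hHsum : ∑ x ∈ H, (#(star F x) : ℝ) ≤ m + K₂ ^ 2 * θ * N := by
    have h1 := sum_card_le_card_biUnion_add H (star F) D fun x _ y _ hxy => hinter x y hxy
    rw [hHunion, hF.1.2] at h1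
    have h2 : ∑ x ∈ H, (#(star F x) : ℝ) ≤ m + #H ^ 2 * D := by exact_mod_cast h1
    refine h2.trans (add_le_add_right ?_ _)
    calc (#H : ℝ) ^ 2 * D ≤ K₂ ^ 2 * (θ * N) := by gcongr
      _ = _ := by ring
  obtain ⟨hHeq, hfinal⟩ := card_eq_and_forall_le_card_star (η₂ := C₁ * θ) (δ := δ') ht htN hε
    hεN hεℓ hstar hx₀N ha1 hx₀max hlarge hmem hfull hHℓ hδ'0.le (by linarith)
    hHsum hmr' hmN (by
      have h1 : #H * δ' ≤ K₂ * δ' := by gcongr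
      have h2 : C₃ * θ = K₂ ^ 2 * θ + K₂ * δ' := by rw [hC₃, hδ'C]; ring
      linarith) (by linarith) (by
      have h4 := sum_choose_star_le (F := F) Hᶜ (u := K₂ * θ) ht hN1 rfl hstar hsum
        (fun x hx => hout x (mem_compl.1 hx)) (by positivity)
      have h5 := sum_add_sum_compl H fun x => ((#(star F x)).choose t : ℝ)
      have h6 : C₁ * θ * N.choose t = (ℓ ^ 2 * θ + (ℓ + 1) * θ) * N.choose t +
          K₂ * θ * K * N.choose t := by rw [hC₁]; ring
      linarith)
  refine ⟨H, hHeq, fun x hx => ?_, hHunion.symm⟩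
  rw [← hNe]
  exact hfinal x hx

end Main

/-! ### Passing to a sequence of errors -/

/-- A property that holds eventually for every fixed error holds for a suitable sequence of errors
that tends to `0`. -/
theorem exists_tendsto_of_eventually {P : ℕ → ℝ → Prop}
    (hmono : ∀ n ε ε', ε ≤ ε' → P n ε → P n ε')
    (h : ∀ ε > 0, ∀ᶠ n in Filter.atTop, P n ε) :
    ∃ (n₀ : ℕ) (ε : ℕ → ℝ), Filter.Tendsto ε Filter.atTop (nhds 0) ∧ ∀ n, n₀ ≤ n → P n (ε n) := by
  obtain ⟨n₀, hn₀⟩ := Filter.eventually_atTop.1 (h 1 one_pos)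
  have hbdd : ∀ n, BddBelow {ε : ℝ | 0 < ε ∧ P n ε} := fun n => ⟨0, fun ε hε => hε.1.le⟩
  refine ⟨n₀, fun n => sInf {ε : ℝ | 0 < ε ∧ P n ε} + 1 / ((n : ℝ) + 1), ?_, fun n hn => ?_⟩
  · suffices hlim : Filter.Tendsto (fun n => sInf {ε : ℝ | 0 < ε ∧ P n ε}) Filter.atTop (nhds 0) by
      simpa using hlim.add (tendsto_one_div_add_atTop_nhds_zero_nat (𝕜 := ℝ))
    refine Metric.tendsto_atTop.2 fun δ hδ => ?_
    obtain ⟨n₁, hn₁⟩ := Filter.eventually_atTop.1 (h (δ / 2) (by positivity))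
    refine ⟨n₁, fun n hn => ?_⟩
    have h1 : sInf {ε : ℝ | 0 < ε ∧ P n ε} ≤ δ / 2 :=
      csInf_le (hbdd n) ⟨by positivity, hn₁ n hn⟩
    have h2 : 0 ≤ sInf {ε : ℝ | 0 < ε ∧ P n ε} := Real.sInf_nonneg fun ε hε => hε.1.le
    rw [Real.dist_eq, sub_zero, abs_of_nonneg h2]
    linarith
  · have hne : {ε : ℝ | 0 < ε ∧ P n ε}.Nonempty := ⟨1, one_pos, hn₀ n hn⟩
    have hpos : (0 : ℝ) < 1 / ((n : ℝ) + 1) := by positivity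
    obtain ⟨ε, hε, hlt⟩ := (csInf_lt_iff (hbdd n) hne).1 (lt_add_of_pos_right
      (sInf {ε : ℝ | 0 < ε ∧ P n ε}) hpos)
    exact hmono n _ _ hlt.le hε.2

theorem eventually_choose_le_mul_choose {k : ℕ} (hk : 2 ≤ k) {κ : ℝ} (hκ : 0 < κ) :
    ∀ᶠ n : ℕ in Filter.atTop,
      ((n - 2).choose (k - 2) : ℝ) ≤ κ * (n - 1).choose (k - 1) := by
  filter_upwards [Filter.eventually_ge_atTop 2,
    tendsto_natCast_atTop_atTop.eventually_ge_atTop ((k : ℝ) / κ + 1)] with n hn2 hn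
  have h := Nat.add_one_mul_choose_eq (n - 2) (k - 2)
  rw [show n - 2 + 1 = n - 1 by omega, show k - 2 + 1 = k - 1 by omega] at h
  have h' : ((n - 1 : ℕ) : ℝ) * (n - 2).choose (k - 2) =
      (n - 1).choose (k - 1) * (k - 1 : ℕ) := by exact_mod_cast h
  have hn1 : (0 : ℝ) < (n - 1 : ℕ) := by
    have : 0 < n - 1 := by omega
    exact_mod_cast this
  have hkn : ((k - 1 : ℕ) : ℝ) ≤ κ * (n - 1 : ℕ) := by
    have h1 : ((k - 1 : ℕ) : ℝ) ≤ k := by exact_mod_cast Nat.sub_le k 1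
    have h2 : (k : ℝ) / κ ≤ (n - 1 : ℕ) := by
      rw [Nat.cast_sub (by omega : 1 ≤ n), Nat.cast_one]
      linarith
    rw [div_le_iff₀ hκ] at h2
    linarith
  refine le_of_mul_le_mul_left ?_ hn1
  rw [h']
  calc ((n - 1).choose (k - 1) : ℝ) * (k - 1 : ℕ) ≤
      (n - 1).choose (k - 1) * (κ * (n - 1 : ℕ)) := by gcongr
    _ = _ := by ring

end SetFamily

theorem theorem1p4 (k ℓ : ℕ) (hk : 1 ≤ k) :
    ∃ (n₀ : ℕ) (ε : ℕ → ℝ), Filter.Tendsto ε Filter.atTop (nhds 0) ∧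
      ∀ n : ℕ, n₀ ≤ n → ∀ t m : ℕ, 2 ≤ t → t ≤ (n - 1).choose (k - 1) →
        n.choose k - (n - ℓ).choose k ≤ m → m ≤ n.choose k - (n - ℓ - 1).choose k →
        ∀ F : Finset (Finset (Fin n)), SetFamily.IsOptimal k m t F →
          SetFamily.ContainsFullStars k ℓ F ∨
            SetFamily.ConsistsOfAlmostFullStars k (ℓ + 1) (ε n) F := by
  refine SetFamily.exists_tendsto_of_eventually (P := fun n ε => ∀ t m : ℕ, 2 ≤ t →
    t ≤ (n - 1).choose (k - 1) → n.choose k - (n - ℓ).choose k ≤ m →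
    m ≤ n.choose k - (n - ℓ - 1).choose k → ∀ F : Finset (Finset (Fin n)),
    SetFamily.IsOptimal k m t F → SetFamily.ContainsFullStars k ℓ F ∨
      SetFamily.ConsistsOfAlmostFullStars k (ℓ + 1) ε F) ?_ ?_
  · intro n ε ε' hε h t m ht htN hm hm' F hF
    refine (h t m ht htN hm hm' F hF).imp_right ?_
    rintro ⟨X, hX, hstar, hFX⟩
    refine ⟨X, hX, fun x hx => le_trans ?_ (hstar x hx), hFX⟩
    gcongr
  · intro ε hε
    obtain rfl | hk2 : k = 1 ∨ 2 ≤ k := by omega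
    · -- a star consists of a single set, so that there is no admissible `t`
      refine Filter.Eventually.of_forall fun n t m ht htN => ?_
      rw [Nat.sub_self, Nat.choose_zero_right] at htN
      omega
    obtain ⟨ε₁, hε₁, hε₁ℓ, hε₁ε⟩ : ∃ ε₁ : ℝ, 0 < ε₁ ∧ ε₁ ≤ 1 / (8 * (ℓ + 2)) ∧ 2 * ε₁ ≤ ε := by
      refine ⟨min (1 / (8 * (ℓ + 2))) (ε / 2), by positivity, min_le_left _ _, ?_⟩
      linarith [min_le_right (1 / (8 * ((ℓ : ℝ) + 2))) (ε / 2)]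
    obtain ⟨κ, hκ, h⟩ := SetFamily.exists_forall_containsFullStars_or hk2 hε₁ hε₁ℓ
    filter_upwards [Filter.eventually_gt_atTop ℓ, Filter.eventually_ge_atTop k,
      SetFamily.eventually_choose_le_mul_choose hk2 hκ] with n hnℓ hnk hnκ t m ht htN hm hm' F hF
    refine (h n hnℓ (Nat.choose_pos (by omega)) hnκ t m ht htN hm hm' F hF).imp_right ?_
    rintro ⟨X, hX, hstar, hFX⟩
    refine ⟨X, hX, fun x hx => le_trans ?_ (hstar x hx), hFX⟩
    gcongr
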